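/- **Setting.** Fix a multilayer perceptron (MLP) architecture: $L$ layers with fixed widths, where layer $l+1$ is obtained from layer $l$ by an affine map followed by an activation function $\varphi_l$ applied coordinatewise. Each $\varphi_l:\mathbb R\to\mathbb R$ is of class $C^3$ with bounded derivatives of orders $1,2,3$ (e.g. $\tanh$, the logistic function, or the identity for linear output units). Let $W\in\mathbb R^p$ be the vector of all weights and biases and $F_W:\mathbb R^m\to\mathbb R^d$ the function represented by the MLP with weights $W$. Write $\partial_kF_W(z)\in\mathbb R^d$ for its partial derivative with respect to $W_k$. Let $(Y_t,Z_t)_{t\ge1}$ be i.i.d. random vectors in $\mathbb R^d\times\mathbb R^m$ with $$Y_t=F_{W^0}(Z_t)+\varepsilon_t ,$$ where the noise $\varepsilon_t$ is independent of $Z_t$, centred, square integrable, with invertible covariance matrix $\Gamma_0$, and $E\|Z_t\|^3<\infty$. Write $Z$ for a random vector with the law of $Z_1$. Let $\Theta\subset\mathbb R^p$ be a compact parameter set with $W^0$ in its interior, and suppose that $W^0$ is identifiable in $\Theta$: if $W\in\Theta$ and $F_W(Z)=F_{W^0}(Z)$ almost surely, then $W=W^0$. Let $I_0$ be the $p\times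 p$ matrix $$(I_0)_{kl}=\mathrm{tr}\Big(\Gamma_0^{-1}\,E\big[\partial_kF_{W^0}(Z)\,\partial_lF_{W^0}(Z)^T\big]\Big)$$ and suppose that $I_0$ is positive definite. **Estimators.** For each $n$ let $\hat W_n$ and $W_n^*$ be random vectors that almost surely minimise over $\Theta$, respectively, $$U_n(W)=\log\det\Big(\frac1n\sum_{t=1}^n (Y_t-F_W(Z_t))(Y_t-F_W(Z_t))^T\Big)\qquad(\log 0=-\infty)$$ and the generalised least squares cost with the true noise covariance, $$\frac1n\sum_{t=1}^n (Y_t-F_W(Z_t))^T\,\Gamma_0^{-1}\,(Y_t-F_W(Z_t)).$$ **Proposition.** As $n\to\infty$, both $\sqrt n(\hat W_n-W^0)$ and $\sqrt n(W_n^*-W^0)$ converge in law to $\mathcal N(0,I_0^{-1})$. In particular $\hat W_n$ is asymptotically optimal, in the sense that $\sqrt n(\hat W_n-W^0)$ has the same limit law as $\sqrt n(W_n^*-W^0)$, the generalised least squares estimator using the true noise covariance. -/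

import Mathlib

open MeasureTheory ProbabilityTheory Filter Topology Matrix

noncomputable section

/-- The architecture of a (fully connected, feed-forward) multilayer perceptron: `depth` layers of
computing units, `width l` the number of units of layer `l` (layer `0` is the input, layer `depth`
is the output), and `act l` the activation function that is applied when passing from layer `l`
to layer `l + 1`. Linear output units are obtained with `act (depth - 1) = id`. -/
structure MLP where
  depth : ℕ
  width : ℕ → ℕ
  act : ℕ → ℝ → ℝ

namespace MLP

variable (A : MLP)

/-- Indices of the weights. `⟨l, i, some j⟩` is the weight of the connection from unit `j` of
layer `l` to unit `i` of layer `l + 1`; `⟨l, i, none⟩` is the bias of unit `i` of layer `l + 1`. -/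
abbrev WeightIdx : Type :=
  Σ l : Fin A.depth, Fin (A.width (l + 1)) × Option (Fin (A.width l))

/-- The space of weight vectors, with its Euclidean norm. -/
abbrev Weights : Type := EuclideanSpace ℝ A.WeightIdx

abbrev Input : Type := EuclideanSpace ℝ (Fin (A.width 0))

abbrev Output : Type := EuclideanSpace ℝ (Fin (A.width A.depth))

/-- The vector of the values of the units of layer `l`, for weights `W` and input `z`. -/
def layer (W : A.Weights) (z : A.Input) : (l : ℕ) → l ≤ A.depth → Fin (A.width l) → ℝ
  | 0, _ => fun i => z i
  | l + 1, h => fun i =>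
      A.act l (W ⟨⟨l, h⟩, i, none⟩ +
        ∑ j : Fin (A.width l), W ⟨⟨l, h⟩, i, some j⟩ * layer W z l (Nat.le_of_succ_le h) j)

/-- The function `F_W` represented by the perceptron with weights `W`. -/
def F (W : A.Weights) (z : A.Input) : A.Output :=
  WithLp.toLp 2 (A.layer W z A.depth le_rfl)

/-- The partial derivative `∂F_W(z)/∂W_k`, a vector of the output space. -/
def partialF (W : A.Weights) (k : A.WeightIdx) (z : A.Input) : A.Output :=
  fderiv ℝ (fun V : A.Weights => A.F V z) W (EuclideanSpace.single k 1)

/-- The activation functions are three times continuously differentiable, with bounded derivatives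
of orders one, two and three (for example `tanh`, the logistic function, or the identity). -/
def SmoothActivations : Prop :=
  ∀ l < A.depth, ContDiff ℝ 3 (A.act l) ∧
    ∃ C : ℝ, ∀ k ∈ Finset.Icc 1 3, ∀ x : ℝ, |iteratedDeriv k (A.act l) x| ≤ C

/-- The empirical error covariance matrix
`(1/n) ∑ (y_t - F_W(z_t)) (y_t - F_W(z_t))ᵀ` of the first `n` observations. -/
def empCov (y : ℕ → A.Output) (z : ℕ → A.Input) (n : ℕ) (W : A.Weights) :
    Matrix (Fin (A.width A.depth)) (Fin (A.width A.depth)) ℝ :=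
  (1 / (n : ℝ)) • ∑ t ∈ Finset.range n,
    vecMulVec (y t - A.F W (z t)).ofLp (y t - A.F W (z t)).ofLp

/-- The cost `U_n(W)`, the logarithm of the determinant of the empirical error covariance matrix.
That determinant is nonnegative; where it vanishes, the cost is `-∞`. -/
def logDetCost (y : ℕ → A.Output) (z : ℕ → A.Input) (n : ℕ) (W : A.Weights) : EReal :=
  ENNReal.log (ENNReal.ofReal (A.empCov y z n W).det)

/-- The generalised least squares cost
`(1/n) ∑ (y_t - F_W(z_t))ᵀ Γ⁻¹ (y_t - F_W(z_t))`. -/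
def glsCost (Γ : Matrix (Fin (A.width A.depth)) (Fin (A.width A.depth)) ℝ)
    (y : ℕ → A.Output) (z : ℕ → A.Input) (n : ℕ) (W : A.Weights) : ℝ :=
  (1 / (n : ℝ)) * ∑ t ∈ Finset.range n,
    (y t - A.F W (z t)).ofLp ⬝ᵥ (Γ⁻¹ *ᵥ (y t - A.F W (z t)).ofLp)

variable {Ω : Type*} [MeasurableSpace Ω]

/-- The matrix with entries `tr (Γ⁻¹ E[∂_k F_W(Z) (∂_l F_W(Z))ᵀ])`. -/
def infoMatrix (P : Measure Ω) (Γ : Matrix (Fin (A.width A.depth)) (Fin (A.width A.depth)) ℝ)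
    (Z : Ω → A.Input) (W : A.Weights) : Matrix A.WeightIdx A.WeightIdx ℝ :=
  Matrix.of fun k l =>
    (Γ⁻¹ * Matrix.of fun i j =>
      ∫ ω, A.partialF W k (Z ω) i * A.partialF W l (Z ω) j ∂P).trace

end MLP

/-- The covariance matrix of a random vector. -/
def covarianceMatrix {Ω : Type*} [MeasurableSpace Ω] {d : ℕ} (P : Measure Ω)
    (X : Ω → EuclideanSpace ℝ (Fin d)) : Matrix (Fin d) (Fin d) ℝ :=
  Matrix.of fun i j => cov[fun ω => X ω i, fun ω => X ω j; P]

/-- `X n` converges in law to the probability measure `ν`. -/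
def ConvergesInLaw {Ω E : Type*} [MeasurableSpace Ω] [TopologicalSpace E] [MeasurableSpace E]
    [OpensMeasurableSpace E] (P : Measure Ω) [IsProbabilityMeasure P]
    (X : ℕ → Ω → E) (ν : Measure E) [IsProbabilityMeasure ν] : Prop :=
  TendstoInDistribution X atTop id (fun _ => P) ν

/-- Two sequences of random vectors have the same asymptotic law: some probability measure is the
limit in law of both. -/
def SameAsymptoticLaw {Ω E : Type*} [MeasurableSpace Ω] [TopologicalSpace E] [MeasurableSpace E]
    [OpensMeasurableSpace E] (P : Measure Ω) [IsProbabilityMeasure P]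
    (X X' : ℕ → Ω → E) : Prop :=
  ∃ (ν : Measure E) (_ : IsProbabilityMeasure ν), ConvergesInLaw P X ν ∧ ConvergesInLaw P X' ν

end

set_option linter.unusedSectionVars false

/-! ### Positive definite matrices and the concavity of log det -/

section MatrixLemmas

variable {κ : Type*} [Fintype κ] [DecidableEq κ]

/-! Write Sₙ(W) for the empirical error covariance. Both estimators are minimisers of a generalised
least squares cost tr(M Sₙ(W)) whose weight matrix M tends almost surely to Γ₀⁻¹. For `Wstar` the
weight is Γ₀⁻¹ itself. For `What` it is Sₙ(What)⁻¹, as soon as this exists: the tangent plane of the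
concave function log det at Sₙ(What) shows that a minimiser of det Sₙ also minimises tr(Sₙ(What)⁻¹
Sₙ(W)) (`Matrix.PosDef.trace_inv_mul_le_of_det_le`). So one theorem,
`RegressionModel.tendstoInDistribution_of_isMinOn`, gives both limits, and the determinant is never
differentiated.

Consistency: by a uniform strong law, Sₙ(W) tends to Γ₀ + B(W) uniformly on Θ, where B(W) is the
second moment matrix of F_W(Z) - F_{W⁰}(Z); the cross terms vanish because the noise is centred and
independent of Z. If either limiting cost at W is at most its value at W⁰, then B(W) = 0, and
identifiability gives W = W⁰.

Normality: the first-order condition is expanded around W⁰, pathwise, with the help of the uniform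
convergence of the second derivatives of Sₙ (`norm_hessian_sub_add_le_of_isMinOn`). The estimation
error is -½ I₀⁻¹ times the gradient of tr(Γ₀⁻¹ Sₙ) at W⁰, up to o(‖Sₙ'(W⁰)‖). Replacing M by its
limit only affects the remainder, which is why estimating the covariance costs nothing
asymptotically. Since √n Sₙ'(W⁰) is a normalised sum of i.i.d. centred square integrable vectors, it
is bounded in L²: the remainder vanishes in probability and the main term obeys the central limit
theorem. The limiting Hessian is 2 I₀ and the score has covariance I₀, so the limit covariance is
I₀⁻¹ I₀ I₀⁻¹ = I₀⁻¹.

The perceptron enters only through smoothness and polynomial growth in the input of F_W and its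
first two weight derivatives, proved by induction on the layers (`ParamGrowth`). -/

open scoped MatrixOrder ComplexOrder in
theorem Matrix.PosDef.exists_isUnit_conjTranspose_mul_self {A : Matrix κ κ ℝ} (hA : A.PosDef) :
    ∃ R : Matrix κ κ ℝ, IsUnit R ∧ A = Rᴴ * R := by
  obtain ⟨R, hR⟩ := CStarAlgebra.nonneg_iff_eq_star_mul_self.mp hA.posSemidef.nonneg
  refine ⟨R, ?_, hR⟩
  have h := hA.isUnit
  rw [Matrix.isUnit_iff_isUnit_det] at h ⊢
  rw [hR, det_mul] at h
  exact isUnit_of_mul_isUnit_right h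

/-- The arithmetic-geometric mean inequality for eigenvalues. -/
theorem Matrix.PosSemidef.card_le_trace {C : Matrix κ κ ℝ} (hC : C.PosSemidef) (h1 : 1 ≤ C.det) :
    (Fintype.card κ : ℝ) ≤ C.trace := by
  have hdet := hC.isHermitian.det_eq_prod_eigenvalues
  have htr := hC.isHermitian.trace_eq_sum_eigenvalues
  simp only [RCLike.ofReal_real_eq_id, id_eq] at hdet htr
  have hne : ∀ i, hC.isHermitian.eigenvalues i ≠ 0 := by
    intro i hi
    rw [hdet, Finset.prod_eq_zero (Finset.mem_univ i) hi] at h1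
    linarith
  have hlog : 0 ≤ ∑ i, Real.log (hC.isHermitian.eigenvalues i) := by
    rw [← Real.log_prod (fun i _ => hne i), ← hdet]
    exact Real.log_nonneg h1
  have hle : ∑ i, Real.log (hC.isHermitian.eigenvalues i) ≤
      ∑ i, (hC.isHermitian.eigenvalues i - 1) :=
    Finset.sum_le_sum fun i _ =>
      Real.log_le_sub_one_of_pos (lt_of_le_of_ne (hC.eigenvalues_nonneg i) (hne i).symm)
  rw [htr]
  simp only [Finset.sum_sub_distrib, Finset.sum_const, Finset.card_univ, nsmul_eq_mul,
    mul_one] at hle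
  linarith

/-- Concavity of `log det`, in the form of its supporting hyperplane at `A`. -/
theorem Matrix.PosDef.card_le_trace_inv_mul {A B : Matrix κ κ ℝ} (hA : A.PosDef)
    (hB : B.PosSemidef) (h : A.det ≤ B.det) : (Fintype.card κ : ℝ) ≤ (A⁻¹ * B).trace := by
  obtain ⟨R, hR, rfl⟩ := hA.exists_isUnit_conjTranspose_mul_self
  have hdR : IsUnit R.det := (Matrix.isUnit_iff_isUnit_det _).1 hR
  have hpos := hA.det_pos
  have hC : ((R⁻¹)ᴴ * B * R⁻¹).PosSemidef := hB.conjTranspose_mul_mul_same _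
  have htr : ((Rᴴ * R)⁻¹ * B).trace = ((R⁻¹)ᴴ * B * R⁻¹).trace := by
    rw [Matrix.mul_inv_rev, Matrix.conjTranspose_nonsing_inv, Matrix.mul_assoc,
      Matrix.trace_mul_comm]
  rw [htr]
  refine hC.card_le_trace ?_
  have hne : R.det ≠ 0 := hdR.ne_zero
  have hinv : R⁻¹.det = (R.det)⁻¹ := by simp
  rw [det_mul, det_conjTranspose, star_trivial] at h hpos
  rw [det_mul, det_mul, det_conjTranspose, star_trivial, hinv]
  have : (R.det)⁻¹ * B.det * (R.det)⁻¹ = B.det / (R.det * R.det) := by field_simp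
  rw [this, le_div_iff₀ hpos]
  linarith

/-- This is the bridge between the two costs: with A the error covariance at a minimiser of the
determinant, that minimiser also minimises the least squares cost weighted by A⁻¹. -/
theorem Matrix.PosDef.trace_inv_mul_le_of_det_le {A B : Matrix κ κ ℝ} (hA : A.PosDef)
    (hB : B.PosSemidef) (h : A.det ≤ B.det) : (A⁻¹ * A).trace ≤ (A⁻¹ * B).trace := by
  rw [Matrix.nonsing_inv_mul _ ((Matrix.isUnit_iff_isUnit_det _).1 hA.isUnit), Matrix.trace_one]
  exact hA.card_le_trace_inv_mul hB h

/-- Writing A = RᴴR turns the trace into that of the positive semidefinite matrix R B Rᴴ, which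
vanishes when its trace does; R is then cancelled on both sides. It identifies the minimiser of the
limiting least squares cost. -/
theorem Matrix.PosDef.eq_zero_of_trace_mul_nonpos {A B : Matrix κ κ ℝ} (hA : A.PosDef)
    (hB : B.PosSemidef) (h : (A * B).trace ≤ 0) : B = 0 := by
  obtain ⟨R, hR, rfl⟩ := hA.exists_isUnit_conjTranspose_mul_self
  have hdR : IsUnit R.det := (Matrix.isUnit_iff_isUnit_det _).1 hR
  have hC : (R * B * Rᴴ).PosSemidef := hB.mul_mul_conjTranspose_same _
  have htr : (Rᴴ * R * B).trace = (R * B * Rᴴ).trace := by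
    rw [Matrix.mul_assoc, Matrix.trace_mul_comm]
  have h0 : R * B * Rᴴ = 0 :=
    hC.trace_eq_zero_iff.1 (le_antisymm (htr ▸ h) hC.trace_nonneg)
  have hRt : IsUnit Rᴴ := (Matrix.isUnit_conjTranspose R).2 hR
  have h1 : R * B = 0 := (hRt.mul_left_eq_zero).1 h0
  exact (hR.mul_right_eq_zero).1 h1

/-- The supporting hyperplane is taken at A + B, not at A: it gives tr((A + B)⁻¹ B) ≤ 0. It
identifies the minimiser of the limiting determinant. -/
theorem Matrix.PosDef.eq_zero_of_det_add_le {A B : Matrix κ κ ℝ} (hA : A.PosDef)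
    (hB : B.PosSemidef) (h : (A + B).det ≤ A.det) : B = 0 := by
  have hAB : (A + B).PosDef := hA.add_posSemidef hB
  have h1 := hAB.trace_inv_mul_le_of_det_le hA.posSemidef h
  rw [Matrix.mul_add, Matrix.trace_add] at h1
  exact hAB.inv.eq_zero_of_trace_mul_nonpos hB (by linarith)

end MatrixLemmas

/-! ### Deterministic asymptotics of minimisers -/

section Argmin

theorem eventually_norm_sub_le {X G : Type*} [SeminormedAddCommGroup G] {l : Filter X} {f : X → G}
    {a : G} (h : Tendsto f l (𝓝 a)) {δ : ℝ} (hδ : 0 < δ) : ∀ᶠ x in l, ‖f x - a‖ ≤ δ :=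
  (tendsto_iff_norm_sub_tendsto_zero.1 h).eventually (ge_mem_nhds hδ)

variable {E V : Type*}

/-- Consistency of approximate extremum estimators: minimisers of `h ∘ S n` over a compact set
converge to the unique minimiser of `h ∘ S₀` when `S n` converges to `S₀` uniformly. -/
theorem tendsto_of_isMinOn_of_tendstoUniformlyOn [PseudoMetricSpace E] [UniformSpace V]
    {Θ : Set E} (hΘ : IsCompact Θ) {S : ℕ → E → V} {S₀ : E → V}
    (hS : TendstoUniformlyOn S S₀ atTop Θ) (hS₀ : ContinuousOn S₀ Θ)
    {h : V → ℝ} (hh : Continuous h) {w₀ : E} (hw₀ : w₀ ∈ Θ)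
    (huniq : ∀ w ∈ Θ, h (S₀ w) ≤ h (S₀ w₀) → w = w₀) {w : ℕ → E} (hw : ∀ n, w n ∈ Θ)
    (hmin : ∀ n, IsMinOn (fun v => h (S n v)) Θ (w n)) : Tendsto w atTop (𝓝 w₀) := by
  -- By compactness it suffices that every cluster point v equals w₀; passing to the limit in the
  -- minimality inequality along a subsequence shows that v does at least as well as w₀ for the
  -- limiting cost.
  refine hΘ.tendsto_nhds_of_unique_mapClusterPt (Eventually.of_forall hw) fun v hv hcl => ?_
  obtain ⟨φ, hφ, hφv⟩ := hcl.tendsto_subseq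
  have hSφ : TendstoUniformlyOn (fun n => S (φ n)) S₀ atTop Θ :=
    fun u hu => hφ.tendsto_atTop.eventually (hS u hu)
  have hl : Tendsto (fun n => h (S (φ n) (w (φ n)))) atTop (𝓝 (h (S₀ v))) :=
    (hh.tendsto _).comp (hSφ.tendsto_comp (hS₀ v hv)
      (tendsto_nhdsWithin_iff.2 ⟨hφv, Eventually.of_forall fun n => hw _⟩))
  have hr : Tendsto (fun n => h (S (φ n) w₀)) atTop (𝓝 (h (S₀ w₀))) :=
    (hh.tendsto _).comp (hSφ.tendsto_at hw₀)
  exact huniq v hv (le_of_tendsto_of_tendsto' hl hr fun n => hmin (φ n) hw₀)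

variable [NormedAddCommGroup E] [NormedSpace ℝ E] [NormedAddCommGroup V] [NormedSpace ℝ V]

/-- First-order expansion of the minimisers of `M n ∘ S n` around `w₀`. -/
theorem norm_hessian_sub_add_le_of_isMinOn {Θ : Set E} {w₀ : E} (hw₀ : w₀ ∈ interior Θ)
    {S : ℕ → E → V} (hS : ∀ n, ContDiff ℝ 2 (S n)) {H : E → E →L[ℝ] E →L[ℝ] V}
    (hH : ContinuousOn H Θ)
    (hunif : TendstoUniformlyOn (fun n v => fderiv ℝ (fderiv ℝ (S n)) v) H atTop Θ)
    {M : ℕ → V →L[ℝ] ℝ} {M₀ : V →L[ℝ] ℝ} (hM : Tendsto M atTop (𝓝 M₀))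
    {w : ℕ → E} (hw : Tendsto w atTop (𝓝 w₀))
    (hmin : ∀ᶠ n in atTop, IsMinOn (fun v => M n (S n v)) Θ (w n))
    {c : ℝ} (hc : ∀ v, ‖v‖ ≤ c * ‖M₀ ∘L (H w₀ v)‖) {e : ℝ} (he : 0 < e) :
    ∀ᶠ n in atTop, ‖M₀ ∘L (H w₀ (w n - w₀)) + M₀ ∘L (fderiv ℝ (S n) w₀)‖ ≤
      e * ‖fderiv ℝ (S n) w₀‖ := by
  set Ψ : (V →L[ℝ] ℝ) → (E →L[ℝ] E →L[ℝ] V) → (E →L[ℝ] E →L[ℝ] ℝ) :=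
    fun M B => (ContinuousLinearMap.compL ℝ E V ℝ M) ∘L B with hΨ
  have hΨapp : ∀ M B v, Ψ M B v = M ∘L (B v) := fun M B v => rfl
  have hΨc : Continuous fun p : (V →L[ℝ] ℝ) × (E →L[ℝ] E →L[ℝ] V) => Ψ p.1 p.2 := by
    simp only [hΨ]; fun_prop
  have hH₀ : ContinuousAt H w₀ := hH.continuousAt (mem_interior_iff_mem_nhds.1 hw₀)
  -- choice of a small constant
  set c' : ℝ := max c 1 with hc'
  have hc'1 : 1 ≤ c' := le_max_right _ _
  have hc'' : ∀ v, ‖v‖ ≤ c' * ‖M₀ ∘L (H w₀ v)‖ := fun v =>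
    (hc v).trans (mul_le_mul_of_nonneg_right (le_max_left _ _) (norm_nonneg _))
  set K : ℝ := ‖M₀‖ + 1 with hK
  have hK0 : 0 < K := by positivity
  -- The first bound makes c' δ ≤ 1/2, so that the term δ‖Δ‖ can be absorbed and ‖Δ‖ ≤ 2 c' K ‖B‖
  -- follows; the second then makes δ‖Δ‖ ≤ (e/2)‖B‖. The other e/2 pays for replacing `M n` by `M₀`.
  set δ : ℝ := min (1 / (2 * c')) (e / (2 * (2 * c' * K))) with hδ
  have hδ0 : 0 < δ := lt_min (by positivity) (by positivity)
  -- uniform closeness of the second derivatives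
  have hev : ∀ᶠ q : ℕ × E in atTop ×ˢ 𝓝 w₀,
      ‖Ψ (M q.1) (fderiv ℝ (fderiv ℝ (S q.1)) q.2) - Ψ M₀ (H w₀)‖ ≤ δ := by
    have h1 : Tendsto (fun q : ℕ × E => fderiv ℝ (fderiv ℝ (S q.1)) q.2) (atTop ×ˢ 𝓝 w₀)
        (𝓝 (H w₀)) := by
      have hu : TendstoUniformlyOn (fun (q : ℕ × E) v => fderiv ℝ (fderiv ℝ (S q.1)) v) H
          (atTop ×ˢ 𝓝 w₀) Θ := fun u hu => tendsto_fst.eventually (hunif u hu)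
      refine hu.tendsto_comp hH₀.continuousWithinAt ?_
      rw [nhdsWithin_eq_nhds.2 (mem_interior_iff_mem_nhds.1 hw₀)]
      exact tendsto_snd
    have h2 : Tendsto (fun q : ℕ × E => M q.1) (atTop ×ˢ 𝓝 w₀) (𝓝 M₀) := hM.comp tendsto_fst
    exact eventually_norm_sub_le (G := E →L[ℝ] E →L[ℝ] ℝ)
      ((hΨc.tendsto (M₀, H w₀)).comp (h2.prodMk_nhds h1)) hδ0
  obtain ⟨pa, hpa, pb, hpb, hab⟩ := eventually_prod_iff.1 hev
  obtain ⟨ρ, hρ, hball⟩ := Metric.eventually_nhds_iff_ball.1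
    (hpb.and (mem_interior_iff_mem_nhds.1 hw₀))
  have hMe : ∀ᶠ n in atTop, ‖M n - M₀‖ ≤ min (e / 2) 1 := by
    have := Metric.tendsto_nhds.1 hM (min (e / 2) 1) (lt_min (half_pos he) one_pos)
    filter_upwards [this] with n hn
    rw [dist_eq_norm] at hn
    exact hn.le
  filter_upwards [hpa, hw.eventually (Metric.ball_mem_nhds w₀ hρ), hMe, hmin]
    with n hna hwn hMn hminn
  have hd1 : ∀ v, HasFDerivAt (S n) (fderiv ℝ (S n) v) v := fun v =>
    ((hS n).differentiable (by norm_num) v).hasFDerivAt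
  have hd2 : ∀ v, HasFDerivAt (fderiv ℝ (S n)) (fderiv ℝ (fderiv ℝ (S n)) v) v := fun v =>
    (((hS n).fderiv_right (m := 1) (by norm_num)).differentiable (by norm_num) v).hasFDerivAt
  -- the first-order condition
  have hwint : Θ ∈ 𝓝 (w n) := Filter.mem_of_superset (Metric.isOpen_ball.mem_nhds hwn)
    fun v hv => (hball v hv).2
  have hfoc : (M n) ∘L (fderiv ℝ (S n) (w n)) = 0 :=
    (hminn.isLocalMin hwint).hasFDerivAt_eq_zero ((M n).hasFDerivAt.comp (w n) (hd1 (w n)))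
  -- Mean value inequality for the gradient minus the fixed linear map v ↦ `M₀ ∘L (H w₀ v)`, whose
  -- derivative is at most δ in norm on the whole ball. The gradient vanishes at `w n` by `hfoc`.
  have hmv := (convex_ball w₀ ρ).norm_image_sub_le_of_norm_hasFDerivWithin_le'
    (f := fun v => (M n) ∘L (fderiv ℝ (S n) v)) (φ := Ψ M₀ (H w₀)) (C := δ)
    (f' := fun v => Ψ (M n) (fderiv ℝ (fderiv ℝ (S n)) v))
    (fun v _ => ((ContinuousLinearMap.compL ℝ E V ℝ (M n)).hasFDerivAt.comp v
      (hd2 v)).hasFDerivWithinAt)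
    (fun v hv => hab hna (hball v hv).1) (Metric.mem_ball_self hρ) hwn
  simp only [hfoc, hΨapp] at hmv
  set B := fderiv ℝ (S n) w₀ with hB
  set Δ := w n - w₀ with hΔ
  set X := M₀ ∘L (H w₀ Δ) with hX
  have hXB : ‖X + M n ∘L B‖ ≤ δ * ‖Δ‖ := by
    
    have h : X + M n ∘L B = -(0 - M n ∘L B - X) := by abel
    rw [h, norm_neg]
    exact hmv
  have hMnB : ‖M n ∘L B‖ ≤ K * ‖B‖ := by
    refine (ContinuousLinearMap.opNorm_comp_le _ _).trans
      (mul_le_mul_of_nonneg_right ?_ (norm_nonneg _))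
    calc ‖M n‖ = ‖M₀ + (M n - M₀)‖ := by congr 1; abel
      _ ≤ ‖M₀‖ + ‖M n - M₀‖ := norm_add_le _ _
      _ ≤ ‖M₀‖ + 1 := by gcongr; exact hMn.trans (min_le_right _ _)
  have hXn : ‖X‖ ≤ δ * ‖Δ‖ + K * ‖B‖ := by
    calc ‖X‖ = ‖(X + M n ∘L B) - M n ∘L B‖ := by congr 1; abel
      _ ≤ ‖X + M n ∘L B‖ + ‖M n ∘L B‖ := norm_sub_le _ _
      _ ≤ _ := add_le_add hXB hMnB
  have hΔB : ‖Δ‖ ≤ 2 * c' * K * ‖B‖ := by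
    have h1 := hc'' Δ
    have h2 : c' * ‖X‖ ≤ c' * (δ * ‖Δ‖ + K * ‖B‖) := by gcongr
    have h3 : c' * δ ≤ 1 / 2 := by
      calc c' * δ ≤ c' * (1 / (2 * c')) := by gcongr; exact min_le_left _ _
        _ = 1 / 2 := by field_simp
    nlinarith [norm_nonneg Δ]
  calc ‖X + M₀ ∘L B‖ = ‖(X + M n ∘L B) - (M n - M₀) ∘L B‖ := by
        congr 1; rw [ContinuousLinearMap.sub_comp]; abel
    _ ≤ ‖X + M n ∘L B‖ + ‖(M n - M₀) ∘L B‖ := norm_sub_le _ _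
    _ ≤ δ * (2 * c' * K * ‖B‖) + e / 2 * ‖B‖ := by
        refine add_le_add (hXB.trans (by gcongr))
          ((ContinuousLinearMap.opNorm_comp_le _ _).trans ?_)
        gcongr
        exact hMn.trans (min_le_left _ _)
    _ ≤ e / (2 * (2 * c' * K)) * (2 * c' * K * ‖B‖) + e / 2 * ‖B‖ := by
        gcongr
        exact min_le_right _ _
    _ = e * ‖B‖ := by field_simp; ring

end Argmin

/-! ### Uniform law of large numbers, L² bounds and central limit theorem -/

section Probability

variable {Ω : Type*} [MeasurableSpace Ω] {P : Measure Ω}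

/-- A uniform strong law of large numbers over a compact parameter set. -/
theorem ae_tendstoUniformlyOn_average {E X V : Type*} [TopologicalSpace E] [TopologicalSpace X]
    [SecondCountableTopology X] [MeasurableSpace X] [OpensMeasurableSpace X]
    [NormedAddCommGroup V] [NormedSpace ℝ V] [CompleteSpace V]
    {Θ : Set E} (hΘ : IsCompact Θ) {q : E → X → V} (hq : Continuous (Function.uncurry q))
    {ξ : ℕ → Ω → X} (hξ : ∀ t, Measurable (ξ t)) (hindep : iIndepFun ξ P)
    (hident : ∀ t, IdentDistrib (ξ t) (ξ 0) P P) {g : X → ℝ} (hg : ∀ w ∈ Θ, ∀ x, ‖q w x‖ ≤ g x)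
    (hgi : Integrable (fun ω => g (ξ 0 ω)) P) :
    ContinuousOn (fun w => ∫ ω, q w (ξ 0 ω) ∂P) Θ ∧
    ∀ᵐ ω ∂P, TendstoUniformlyOn (fun (n : ℕ) w => (n : ℝ)⁻¹ • ∑ t ∈ Finset.range n, q w (ξ t ω))
      (fun w => ∫ ω, q w (ξ 0 ω) ∂P) atTop Θ := by
  have : CompactSpace Θ := isCompact_iff_compactSpace.1 hΘ
  let : MeasurableSpace C(Θ, V) := borel _
  have : BorelSpace C(Θ, V) := ⟨rfl⟩
  -- Currying turns the uniform law into the ordinary strong law in the Banach space C(Θ, V), whose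
  -- norm is the sup norm. The limit is an element of this space, so its continuity comes for free.
  let Φ : C(X, C(Θ, V)) :=
    ContinuousMap.curry ⟨fun p : X × Θ => q p.2 p.1, hq.comp ((continuous_subtype_val.comp continuous_snd).prodMk continuous_fst)⟩
  have hΦ : ∀ x (w : Θ), Φ x w = q w x := fun x w => rfl
  have hint : Integrable (fun ω => Φ (ξ 0 ω)) P := by
    refine hgi.norm.mono' (Φ.continuous.stronglyMeasurable.comp_measurable
      (hξ 0)).aestronglyMeasurable (Eventually.of_forall fun ω => ?_)
    refine (ContinuousMap.norm_le _ (norm_nonneg _)).2 fun w => ?_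
    exact (hg w w.2 _).trans (le_abs_self _)
  have hlim : ∀ w : Θ, (∫ ω, Φ (ξ 0 ω) ∂P) w = ∫ ω, q w (ξ 0 ω) ∂P := fun w =>
    ((ContinuousMap.evalCLM ℝ w).integral_comp_comm hint).symm
  constructor
  · rw [continuousOn_iff_continuous_domRestrict]
    exact (∫ ω, Φ (ξ 0 ω) ∂P).continuous.congr hlim
  have := strong_law_ae (fun t ω => Φ (ξ t ω)) hint
    (fun i j hij => (hindep.indepFun hij).comp Φ.continuous.measurable Φ.continuous.measurable)
    (fun t => (hident t).comp Φ.continuous.measurable)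
  filter_upwards [this] with ω hω
  rw [ContinuousMap.tendsto_iff_tendstoUniformly] at hω
  rw [tendstoUniformlyOn_iff_tendstoUniformly_comp_coe]
  convert hω using 1
  · ext n w
    simp [hΦ]
  · ext w
    exact (hlim w).symm

variable [IsProbabilityMeasure P]

/-- Variances of independent terms add up, giving equality for n ≥ 1; the inequality accommodates n
= 0, where (√0)⁻¹ = 0. -/
theorem integral_sq_inv_sqrt_mul_sum_le {η : ℕ → Ω → ℝ} (hindep : iIndepFun η P)
    (hident : ∀ t, IdentDistrib (η t) (η 0) P P) (hη : MemLp (η 0) 2 P) (h0 : ∫ ω, η 0 ω ∂P = 0)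
    (n : ℕ) : ∫ ω, ((√(n : ℝ))⁻¹ * ∑ t ∈ Finset.range n, η t ω) ^ 2 ∂P ≤ Var[η 0; P] := by
  have hL : ∀ t, MemLp (η t) 2 P := fun t => (hident t).memLp_iff.2 hη
  have hi : ∀ t, Integrable (η t) P := fun t => (hL t).integrable one_le_two
  have hvar : ∫ ω, (∑ t ∈ Finset.range n, η t ω) ^ 2 ∂P = n * Var[η 0; P] := by
    have h1 := IndepFun.variance_sum (s := Finset.range n) (fun t _ => hL t)
      (fun i _ j _ hij => hindep.indepFun hij)
    simp only [fun t => (hident t).variance_eq, Finset.sum_const, Finset.card_range,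
      nsmul_eq_mul] at h1
    rw [← h1, variance_of_integral_eq_zero]
    · simp
    · exact (Finset.aemeasurable_sum _ fun t _ => (hi t).aemeasurable)
    · simp only [Finset.sum_apply]
      rw [integral_finsetSum _ fun t _ => hi t]
      simp [fun t => (hident t).integral_eq, h0]
  simp_rw [mul_pow]
  rw [integral_const_mul, hvar]
  rcases Nat.eq_zero_or_pos n with rfl | hn
  · simp [variance_nonneg]
  · have : (n : ℝ) ≠ 0 := by positivity
    rw [inv_pow, Real.sq_sqrt (Nat.cast_nonneg n)]
    field_simp
    exact le_rfl

/-- Normalised sums of i.i.d. centred square integrable vectors are bounded in `L²`. -/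
theorem exists_integral_norm_sq_inv_sqrt_smul_sum_le {G : Type*} [NormedAddCommGroup G]
    [NormedSpace ℝ G] [FiniteDimensional ℝ G] [MeasurableSpace G] [BorelSpace G] {ξ : ℕ → Ω → G}
    (hindep : iIndepFun ξ P) (hident : ∀ t, IdentDistrib (ξ t) (ξ 0) P P)
    (hξ : MemLp (ξ 0) 2 P) (h0 : ∫ ω, ξ 0 ω ∂P = 0) :
    ∃ K : ℝ, ∀ n : ℕ, ∫ ω, ‖(√(n : ℝ))⁻¹ • ∑ t ∈ Finset.range n, ξ t ω‖ ^ 2 ∂P ≤ K := by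
  -- The norm of G need not be Euclidean; Euclidean coordinates reduce the bound to the scalar case
  -- at the cost of the factor ‖e⁻¹‖².
  let e : G ≃L[ℝ] EuclideanSpace ℝ (Fin (Module.finrank ℝ G)) := toEuclidean
  let es : EuclideanSpace ℝ (Fin (Module.finrank ℝ G)) →L[ℝ] G := e.symm
  let φ : Fin (Module.finrank ℝ G) → G →L[ℝ] ℝ := fun a => (EuclideanSpace.proj a) ∘L e.toContinuousLinearMap
  have hφ : ∀ a g, φ a g = e g a := fun a g => rfl
  have hφm : ∀ a, Measurable (φ a) := fun a => (φ a).continuous.measurable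
  have hL : ∀ t, MemLp (ξ t) 2 P := fun t => (hident t).memLp_iff.2 hξ
  refine ⟨‖es‖ ^ 2 * ∑ a, Var[fun ω => φ a (ξ 0 ω); P], fun n => ?_⟩
  have hb : ∀ ω, ‖(√(n : ℝ))⁻¹ • ∑ t ∈ Finset.range n, ξ t ω‖ ^ 2 ≤
      ‖es‖ ^ 2 *
        ∑ a, ((√(n : ℝ))⁻¹ * ∑ t ∈ Finset.range n, φ a (ξ t ω)) ^ 2 := by
    intro ω
    set b := (√(n : ℝ))⁻¹ • ∑ t ∈ Finset.range n, ξ t ω with hb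
    have h1 : ‖b‖ ≤ ‖es‖ * ‖e b‖ := by
      have := es.le_opNorm (e b)
      simpa [es] using this
    have h2 : ‖e b‖ ^ 2 = ∑ a, ((√(n : ℝ))⁻¹ * ∑ t ∈ Finset.range n, φ a (ξ t ω)) ^ 2 := by
      rw [EuclideanSpace.norm_sq_eq]
      refine Finset.sum_congr rfl fun a _ => ?_
      rw [Real.norm_eq_abs, sq_abs, ← hφ, hb, map_smul, map_sum, smul_eq_mul]
    calc ‖b‖ ^ 2 ≤ (‖es‖ * ‖e b‖) ^ 2 := by gcongr
      _ = _ := by rw [mul_pow, h2]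
  have hLφ : ∀ a t, MemLp (fun ω => φ a (ξ t ω)) 2 P := fun a t => (φ a).comp_memLp' (hL t)
  have hi : ∀ a, Integrable
      (fun ω => ((√(n : ℝ))⁻¹ * ∑ t ∈ Finset.range n, φ a (ξ t ω)) ^ 2) P := fun a =>
    ((memLp_finsetSum _ fun t _ => hLφ a t).const_mul _).integrable_sq
  calc _ ≤ ∫ ω, ‖es‖ ^ 2 *
        ∑ a, ((√(n : ℝ))⁻¹ * ∑ t ∈ Finset.range n, φ a (ξ t ω)) ^ 2 ∂P := by
        refine integral_mono_of_nonneg (Eventually.of_forall fun ω => by positivity)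
          ((integrable_finsetSum _ fun a _ => hi a).const_mul _) (Eventually.of_forall hb)
    _ ≤ _ := by
        rw [integral_const_mul, integral_finsetSum _ fun a _ => hi a]
        gcongr with a
        refine integral_sq_inv_sqrt_mul_sum_le (hindep.comp (fun _ => φ a) fun _ => hφm a)
          (fun t => (hident t).comp (hφm a)) (hLφ a 0) ?_ n
        change ∫ ω, φ a (ξ 0 ω) ∂P = 0
        rw [(φ a).integral_comp_comm (hξ.integrable one_le_two), h0, map_zero]

/-- A sequence that is almost surely negligible with respect to an `L²`-bounded sequence
converges to zero in probability. -/
theorem tendstoInMeasure_zero_of_ae_le_mul {E G : Type*} [NormedAddCommGroup E]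
    [NormedAddCommGroup G] {X : ℕ → Ω → E} {R : ℕ → Ω → G}
    (hX : ∀ n, AEStronglyMeasurable (X n) P) (hR : ∀ n, MemLp (R n) 2 P) {K : ℝ}
    (hK : ∀ n, ∫ ω, ‖R n ω‖ ^ 2 ∂P ≤ K)
    (h : ∀ᵐ ω ∂P, ∀ e : ℝ, 0 < e → ∀ᶠ n in atTop, ‖X n ω‖ ≤ e * ‖R n ω‖) :
    TendstoInMeasure P X atTop 0 := by
  -- The ratio tends to zero almost surely, hence in probability. On the event ‖R‖ < T, having ‖X‖ ≥
  -- δ forces ρ ≥ δ / (1 + T), and Markov's inequality controls the complementary event.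
  set ρ : ℕ → Ω → ℝ := fun n ω => ‖X n ω‖ / (1 + ‖R n ω‖) with hρ
  have hρm : ∀ n, AEStronglyMeasurable (ρ n) P := fun n =>
    ((hX n).norm.aemeasurable.div
      ((hR n).1.norm.aemeasurable.const_add 1)).aestronglyMeasurable
  have hρ0 : TendstoInMeasure P ρ atTop 0 := by
    refine tendstoInMeasure_of_tendsto_ae hρm ?_
    filter_upwards [h] with ω hω
    rw [Metric.tendsto_nhds]
    intro e he
    filter_upwards [hω (e / 2) (half_pos he)] with n hn
    have hpos : 0 < 1 + ‖R n ω‖ := by positivity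
    rw [Pi.zero_apply, dist_zero_right, Real.norm_of_nonneg (by positivity), div_lt_iff₀ hpos]
    nlinarith [norm_nonneg (R n ω)]
  rw [tendstoInMeasure_iff_measureReal_norm] at hρ0 ⊢
  intro δ hδ
  simp only [Pi.zero_apply, sub_zero] at hρ0 ⊢
  have hK0 : 0 ≤ K := (integral_nonneg fun ω => by positivity).trans (hK 0)
  rw [Metric.tendsto_nhds]
  intro η hη
  -- T² = 2(K + 1)/η gives K/T² < η/2, and K + 1 keeps T positive when K = 0.
  obtain ⟨T, hT⟩ : ∃ T : ℝ, 0 < T ∧ K / T ^ 2 < η / 2 := by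
    refine ⟨√(2 * (K + 1) / η), by positivity, ?_⟩
    rw [Real.sq_sqrt (by positivity), div_lt_iff₀ (by positivity)]
    field_simp
    linarith
  have h1 := (hρ0 (δ / (1 + T)) (by have := hT.1; positivity)).eventually (gt_mem_nhds (half_pos hη))
  filter_upwards [h1] with n hn
  rw [dist_zero_right, Real.norm_of_nonneg measureReal_nonneg]
  have hmarkov : P.real {ω | T ^ 2 ≤ ‖R n ω‖ ^ 2} ≤ K / T ^ 2 := by
    rw [le_div_iff₀ (by have := hT.1; positivity), mul_comm]
    exact (mul_meas_ge_le_integral_of_nonneg (Eventually.of_forall fun ω => by positivity)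
      (hR n).integrable_norm_pow' _).trans (hK n)
  have hsub : {ω | δ ≤ ‖X n ω‖} ⊆
      {ω | δ / (1 + T) ≤ ‖ρ n ω‖} ∪ {ω | T ^ 2 ≤ ‖R n ω‖ ^ 2} := by
    intro ω hω
    by_cases hc : T ≤ ‖R n ω‖
    · right
      have := hT.1
      simp only [Set.mem_ofPred_eq]
      gcongr
    · left
      push Not at hc
      simp only [Set.mem_ofPred_eq, hρ] at hω ⊢
      rw [Real.norm_of_nonneg (by positivity)]
      gcongr
  calc P.real {ω | δ ≤ ‖X n ω‖} ≤ _ := measureReal_mono hsub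
    _ ≤ _ := measureReal_union_le _ _
    _ < η / 2 + η / 2 := add_lt_add_of_lt_of_le hn (hmarkov.trans hT.2.le)
    _ = η := by ring

/-- The multivariate central limit theorem. -/
theorem tendstoInDistribution_inv_sqrt_smul_sum {ι : Type*} [Fintype ι] [DecidableEq ι]
    {ξ : ℕ → Ω → EuclideanSpace ℝ ι} (hindep : iIndepFun ξ P)
    (hident : ∀ t, IdentDistrib (ξ t) (ξ 0) P P) (hξ : MemLp (ξ 0) 2 P)
    (h0 : ∫ ω, ξ 0 ω ∂P = 0) {S : Matrix ι ι ℝ} (hS : S.PosSemidef)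
    (hcov : ∀ u : EuclideanSpace ℝ ι, ∫ ω, inner ℝ (ξ 0 ω) u ^ 2 ∂P = u ⬝ᵥ S *ᵥ u) :
    TendstoInDistribution (fun (n : ℕ) ω => (√(n : ℝ))⁻¹ • ∑ t ∈ Finset.range n, ξ t ω) atTop id
      (fun _ => P) (multivariateGaussian 0 S) where
  forall_aemeasurable n :=
    (Finset.aemeasurable_fun_sum _ fun t _ => (hident t).aemeasurable_fst).fun_const_smul _
  aemeasurable_limit := aemeasurable_id
  tendsto := by
    refine ProbabilityMeasure.tendsto_iff_tendsto_charFun.2 fun u => ?_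
    have hm : Measurable fun v : EuclideanSpace ℝ ι => inner ℝ v u := by fun_prop
    have hmn : ∀ n : ℕ, AEMeasurable (fun ω => (√(n : ℝ))⁻¹ • ∑ t ∈ Finset.range n, ξ t ω) P :=
      fun n => (Finset.aemeasurable_fun_sum _ fun t _ => (hident t).aemeasurable_fst).fun_const_smul _
    have hL : MemLp (fun ω => inner ℝ (ξ 0 ω) u) 2 P := hξ.inner_const u
    have hmean : ∫ ω, inner ℝ (ξ 0 ω) u ∂P = 0 := by
      simp_rw [real_inner_comm]
      rw [integral_inner (hξ.integrable one_le_two), h0, inner_zero_right]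
    have hvar : Var[fun ω => inner ℝ (ξ 0 ω) u; P] = u ⬝ᵥ S *ᵥ u := by
      rw [variance_of_integral_eq_zero hL.1.aemeasurable hmean]
      exact hcov u
    have hclt := tendstoInDistribution_inv_sqrt_mul_sum_sub
      (X := fun t ω => inner ℝ (ξ t ω) u) (Y := id) (P := P) HasLaw.id hL
      (hindep.comp (fun _ v => inner ℝ v u) fun _ => hm)
      (fun t => (hident t).comp hm)
    -- Cramér–Wold: the characteristic function of a vector at u is that of its inner product with u
    -- at 1.
    have h1 := (ProbabilityMeasure.tendsto_iff_tendsto_charFun.1 hclt.tendsto) 1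
    simp only [ProbabilityMeasure.coe_mk, Measure.map_id] at h1 ⊢
    rw [charFun_gaussianReal, hvar] at h1
    rw [charFun_multivariateGaussian hS]
    have hnn : 0 ≤ u ⬝ᵥ S *ᵥ u := hvar ▸ variance_nonneg _ _
    convert h1 using 1
    · ext n
      rw [charFun_apply, charFun_apply, integral_map (hmn n) (by fun_prop), integral_map _ (by fun_prop)]
      · refine integral_congr_ae (Eventually.of_forall fun ω => ?_)
        simp [hmean, inner_smul_left, sum_inner]
      · exact ((hm.comp_aemeasurable (hmn n)).congr (Eventually.of_forall fun ω => by
          simp [hmean, inner_smul_left, sum_inner]))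
    · congr 2
      simp [Real.coe_toNNReal _ hnn]

end Probability

/-! ### The residual outer product and its parameter derivatives -/

section Regression

variable {d : ℕ} {X : Type*} [NormedAddCommGroup X] [NormedSpace ℝ X]

/-- The linear form `S ↦ tr (M S)`. -/
def tracePairing (M : Matrix (Fin d) (Fin d) ℝ) : (Fin d → Fin d → ℝ) →L[ℝ] ℝ :=
  ∑ i, ∑ j, M i j • ((ContinuousLinearMap.proj i : (Fin d → ℝ) →L[ℝ] ℝ) ∘L
    (ContinuousLinearMap.proj j : (Fin d → Fin d → ℝ) →L[ℝ] (Fin d → ℝ)))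

theorem tracePairing_apply (M : Matrix (Fin d) (Fin d) ℝ) (S : Fin d → Fin d → ℝ) :
    tracePairing M S = ∑ i, ∑ j, M i j * S j i := by
  simp [tracePairing]

theorem tracePairing_eq_trace (M : Matrix (Fin d) (Fin d) ℝ) (S : Fin d → Fin d → ℝ) :
    tracePairing M S = (M * Matrix.of S).trace := by
  simp [tracePairing_apply, Matrix.trace, Matrix.mul_apply]

theorem continuous_tracePairing :
    Continuous (tracePairing : Matrix (Fin d) (Fin d) ℝ → (Fin d → Fin d → ℝ) →L[ℝ] ℝ) := by
  unfold tracePairing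
  refine continuous_finsetSum _ fun i _ => continuous_finsetSum _ fun j _ => ?_
  exact (continuous_id.matrix_elem i j).smul continuous_const

/-- The matrix `(y - o) (y - o)ᵀ`. -/
def errorOuter (y o : EuclideanSpace ℝ (Fin d)) : Fin d → Fin d → ℝ :=
  fun i j => (y i - o i) * (y j - o j)

theorem contDiff_errorOuter {n : WithTop ℕ∞} : ContDiff ℝ n
    fun p : EuclideanSpace ℝ (Fin d) × EuclideanSpace ℝ (Fin d) => errorOuter p.1 p.2 := by
  unfold errorOuter
  refine contDiff_pi.2 fun i => contDiff_pi.2 fun j => ?_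
  fun_prop

theorem abs_coord_le_norm (o : EuclideanSpace ℝ (Fin d)) (i : Fin d) : |o i| ≤ ‖o‖ :=
  PiLp.norm_apply_le o i

theorem norm_errorOuter_le (y o : EuclideanSpace ℝ (Fin d)) :
    ‖errorOuter y o‖ ≤ ‖y - o‖ ^ 2 := by
  refine (pi_norm_le_iff_of_nonneg (by positivity)).2 fun i =>
    (pi_norm_le_iff_of_nonneg (by positivity)).2 fun j => ?_
  rw [errorOuter, Real.norm_eq_abs, abs_mul, sq]
  exact mul_le_mul (abs_coord_le_norm (y - o) i) (abs_coord_le_norm (y - o) j) (abs_nonneg _)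
    (norm_nonneg _)

variable {E : Type*} [NormedAddCommGroup E] [NormedSpace ℝ E]
  {g : E → EuclideanSpace ℝ (Fin d)}

theorem fderiv_errorOuter_apply (hg : ContDiff ℝ 2 g)
    (y : EuclideanSpace ℝ (Fin d)) (w v : E) (i j : Fin d) :
    fderiv ℝ (fun w => errorOuter y (g w)) w v i j =
      -(fderiv ℝ g w v i * (y j - g w j) + (y i - g w i) * fderiv ℝ g w v j) := by
  have hgi : ∀ i, HasFDerivAt (fun w => y i - g w i)
      (-((EuclideanSpace.proj i : _ →L[ℝ] ℝ) ∘L fderiv ℝ g w)) w := fun i =>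
    ((EuclideanSpace.proj i : _ →L[ℝ] ℝ).hasFDerivAt.comp w
      (hg.differentiable (by norm_num) w).hasFDerivAt).const_sub _
  have hS : DifferentiableAt ℝ (fun w => errorOuter y (g w)) w :=
    ((contDiff_errorOuter (n := 2)).comp (contDiff_const.prodMk hg)).differentiable
      (by norm_num) w
  have h1 : HasFDerivAt (fun w => errorOuter y (g w) i j)
      ((ContinuousLinearMap.proj j : (Fin d → ℝ) →L[ℝ] ℝ) ∘L
        (ContinuousLinearMap.proj i : (Fin d → Fin d → ℝ) →L[ℝ] _) ∘L
        fderiv ℝ (fun w => errorOuter y (g w)) w) w :=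
    ((ContinuousLinearMap.proj j : (Fin d → ℝ) →L[ℝ] ℝ) ∘L
        (ContinuousLinearMap.proj i : (Fin d → Fin d → ℝ) →L[ℝ] _)).hasFDerivAt.comp w
      hS.hasFDerivAt
  have h2 := h1.unique ((hgi i).mul (hgi j))
  have h3 := congrArg (fun L => L v) h2
  simp at h3
  rw [h3]
  ring

theorem fderiv_fderiv_errorOuter_apply (hg : ContDiff ℝ 2 g)
    (y : EuclideanSpace ℝ (Fin d)) (w u v : E) (i j : Fin d) :
    fderiv ℝ (fderiv ℝ (fun w => errorOuter y (g w))) w u v i j =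
      fderiv ℝ g w u i * fderiv ℝ g w v j + fderiv ℝ g w v i * fderiv ℝ g w u j
        - (fderiv ℝ (fderiv ℝ g) w u v i * (y j - g w j)
          + (y i - g w i) * fderiv ℝ (fderiv ℝ g) w u v j) := by
  have hgi : ∀ i, HasFDerivAt (fun w => y i - g w i)
      (-((EuclideanSpace.proj i : _ →L[ℝ] ℝ) ∘L fderiv ℝ g w)) w := fun i =>
    ((EuclideanSpace.proj i : _ →L[ℝ] ℝ).hasFDerivAt.comp w
      (hg.differentiable (by norm_num) w).hasFDerivAt).const_sub _
  have hg' : HasFDerivAt (fderiv ℝ g) (fderiv ℝ (fderiv ℝ g) w) w :=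
    ((hg.fderiv_right (m := 1) (by norm_num)).differentiable (by norm_num) w).hasFDerivAt
  have hgvi : ∀ i, HasFDerivAt (fun w => fderiv ℝ g w v i)
      (((EuclideanSpace.proj i : _ →L[ℝ] ℝ) ∘L
        ContinuousLinearMap.apply ℝ (EuclideanSpace ℝ (Fin d)) v) ∘L fderiv ℝ (fderiv ℝ g) w) w :=
    fun i => ((EuclideanSpace.proj i : _ →L[ℝ] ℝ) ∘L
        ContinuousLinearMap.apply ℝ (EuclideanSpace ℝ (Fin d)) v).hasFDerivAt.comp w hg'
  have hS : ContDiff ℝ 2 (fun w => errorOuter y (g w)) :=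
    (contDiff_errorOuter (n := 2)).comp (contDiff_const.prodMk hg)
  have hS' : HasFDerivAt (fderiv ℝ (fun w => errorOuter y (g w)))
      (fderiv ℝ (fderiv ℝ (fun w => errorOuter y (g w))) w) w :=
    ((hS.fderiv_right (m := 1) (by norm_num)).differentiable (by norm_num) w).hasFDerivAt
  have h1 := ((ContinuousLinearMap.proj j : (Fin d → ℝ) →L[ℝ] ℝ) ∘L
        (ContinuousLinearMap.proj i : (Fin d → Fin d → ℝ) →L[ℝ] _) ∘L
        ContinuousLinearMap.apply ℝ (Fin d → Fin d → ℝ) v).hasFDerivAt.comp w hS'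
  -- Stating `h1` for an entry of the first derivative lets the explicit formula be substituted
  -- inside the differentiated function; uniqueness of derivatives then yields the identity.
  have h2 : HasFDerivAt (fun w => fderiv ℝ (fun w => errorOuter y (g w)) w v i j) _ w := h1
  simp only [fderiv_errorOuter_apply hg] at h2
  have h3 := h2.unique (((hgvi i).mul (hgi j)).add ((hgi i).mul (hgvi j))).neg
  have h4 := congrArg (fun L => L u) h3
  simp at h4
  rw [h4]
  ring

theorem norm_fderiv_errorOuter_le (hg : ContDiff ℝ 2 g)
    (y : EuclideanSpace ℝ (Fin d)) (w : E) :
    ‖fderiv ℝ (fun w => errorOuter y (g w)) w‖ ≤ 2 * (‖fderiv ℝ g w‖ * ‖y - g w‖) := by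
  refine ContinuousLinearMap.opNorm_le_bound _ (by positivity) fun v => ?_
  refine (pi_norm_le_iff_of_nonneg (by positivity)).2 fun i =>
    (pi_norm_le_iff_of_nonneg (by positivity)).2 fun j => ?_
  rw [fderiv_errorOuter_apply hg, norm_neg, Real.norm_eq_abs]
  have hr : ∀ i, |y i - g w i| ≤ ‖y - g w‖ := abs_coord_le_norm (y - g w)
  have hd : ∀ i, |fderiv ℝ g w v i| ≤ ‖fderiv ℝ g w‖ * ‖v‖ := fun i =>
    (abs_coord_le_norm _ i).trans ((fderiv ℝ g w).le_opNorm v)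
  calc _ ≤ |fderiv ℝ g w v i| * |y j - g w j| + |y i - g w i| * |fderiv ℝ g w v j| := by
        rw [← abs_mul, ← abs_mul]; exact abs_add_le _ _
    _ ≤ ‖fderiv ℝ g w‖ * ‖v‖ * ‖y - g w‖ + ‖y - g w‖ * (‖fderiv ℝ g w‖ * ‖v‖) := by
        gcongr
        exacts [hd i, hr j, hr i, hd j]
    _ = _ := by ring

theorem norm_fderiv_fderiv_errorOuter_le (hg : ContDiff ℝ 2 g)
    (y : EuclideanSpace ℝ (Fin d)) (w : E) :
    ‖fderiv ℝ (fderiv ℝ (fun w => errorOuter y (g w))) w‖ ≤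
      2 * (‖fderiv ℝ g w‖ ^ 2 + ‖fderiv ℝ (fderiv ℝ g) w‖ * ‖y - g w‖) := by
  refine ContinuousLinearMap.opNorm_le_bound₂ _ (by positivity) fun u v => ?_
  refine (pi_norm_le_iff_of_nonneg (by positivity)).2 fun i =>
    (pi_norm_le_iff_of_nonneg (by positivity)).2 fun j => ?_
  rw [fderiv_fderiv_errorOuter_apply hg, Real.norm_eq_abs]
  have hr : ∀ i, |y i - g w i| ≤ ‖y - g w‖ := abs_coord_le_norm (y - g w)
  have hd : ∀ v i, |fderiv ℝ g w v i| ≤ ‖fderiv ℝ g w‖ * ‖v‖ := fun v i =>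
    (abs_coord_le_norm _ i).trans ((fderiv ℝ g w).le_opNorm v)
  have hdd : ∀ i, |fderiv ℝ (fderiv ℝ g) w u v i| ≤ ‖fderiv ℝ (fderiv ℝ g) w‖ * ‖u‖ * ‖v‖ :=
    fun i => (abs_coord_le_norm _ i).trans ((fderiv ℝ (fderiv ℝ g) w).le_opNorm₂ u v)
  calc _ ≤ (|fderiv ℝ g w u i| * |fderiv ℝ g w v j| + |fderiv ℝ g w v i| * |fderiv ℝ g w u j|)
        + (|fderiv ℝ (fderiv ℝ g) w u v i| * |y j - g w j|
          + |y i - g w i| * |fderiv ℝ (fderiv ℝ g) w u v j|) := by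
        simp only [← abs_mul]
        exact (abs_sub _ _).trans (add_le_add (abs_add_le _ _) (abs_add_le _ _))
    _ ≤ (‖fderiv ℝ g w‖ * ‖u‖ * (‖fderiv ℝ g w‖ * ‖v‖)
          + ‖fderiv ℝ g w‖ * ‖v‖ * (‖fderiv ℝ g w‖ * ‖u‖))
        + (‖fderiv ℝ (fderiv ℝ g) w‖ * ‖u‖ * ‖v‖ * ‖y - g w‖
          + ‖y - g w‖ * (‖fderiv ℝ (fderiv ℝ g) w‖ * ‖u‖ * ‖v‖)) := by
        gcongr
        exacts [hd u i, hd v j, hd v i, hd u j, hdd i, hr j, hr i, hdd j]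
    _ = _ := by ring

/-- The pair (w, x) serves as the parameter of `ContDiff.fderiv`, and each differentiation in w
costs one order of smoothness. Joint continuity is what the uniform strong law asks for. -/
theorem continuous_fderiv_fderiv_of_contDiff_uncurry {F : Type*} [NormedAddCommGroup F]
    [NormedSpace ℝ F] {q : E → X → F} (hq : ContDiff ℝ 2 (Function.uncurry q)) :
    Continuous (Function.uncurry fun w x => fderiv ℝ (fun v => q v x) w) ∧
    Continuous (Function.uncurry fun w x => fderiv ℝ (fderiv ℝ (fun v => q v x)) w) := by
  have h1 : ContDiff ℝ 1 fun p : E × X => fderiv ℝ (fun v => q v p.2) p.1 :=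
    ContDiff.fderiv (f := fun (p : E × X) v => q v p.2)
      (hq.comp (contDiff_snd.prodMk (contDiff_snd.comp contDiff_fst))) contDiff_fst (by norm_num)
  have h2 : ContDiff ℝ 0 fun p : E × X => fderiv ℝ (fderiv ℝ (fun v => q v p.2)) p.1 :=
    ContDiff.fderiv (f := fun (p : E × X) v' => fderiv ℝ (fun v => q v p.2) v')
      (h1.comp (contDiff_snd.prodMk (contDiff_snd.comp contDiff_fst))) contDiff_fst (by norm_num)
  exact ⟨h1.continuous, h2.continuous⟩

end Regression

/-! ### The regression model: integrability and uniform convergence -/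

section RegressionModel

variable {ι : Type*} [Fintype ι] {d : ℕ}
  {X : Type*} [NormedAddCommGroup X] [NormedSpace ℝ X] [SecondCountableTopology X]
  [MeasurableSpace X] [BorelSpace X] {Ω : Type*} [MeasurableSpace Ω]

/-- The quadratic form at x is the expectation of the square of ∑ xᵢ ηᵢ. -/
theorem posSemidef_secondMoment {P : Measure Ω} {η : Ω → EuclideanSpace ℝ (Fin d)}
    (hη : ∀ i, MemLp (fun ω => η ω i) 2 P) :
    (Matrix.of fun i j => ∫ ω, η ω i * η ω j ∂P).PosSemidef := by
  refine .of_dotProduct_mulVec_nonneg ?_ fun x => ?_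
  · ext i j
    simp [Matrix.conjTranspose_apply, mul_comm]
  · have hi : ∀ i j, Integrable (fun ω => x i * (η ω i * η ω j * x j)) P := fun i j =>
      (((hη i).integrable_mul (hη j)).mul_const _).const_mul _
    have : star x ⬝ᵥ (Matrix.of fun i j => ∫ ω, η ω i * η ω j ∂P) *ᵥ x =
        ∫ ω, (∑ i, x i * η ω i) ^ 2 ∂P := by
      have hsq : ∀ ω, (∑ i, x i * η ω i) ^ 2 = ∑ i, ∑ j, x i * (η ω i * η ω j * x j) := by
        intro ω
        simp only [sq, Finset.sum_mul, Finset.mul_sum]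
        rw [Finset.sum_comm]
        exact Finset.sum_congr rfl fun i _ => Finset.sum_congr rfl fun j _ => by ring
      simp_rw [hsq]
      rw [integral_finsetSum _ fun i _ => integrable_finsetSum _ fun j _ => hi i j]
      simp_rw [integral_finsetSum Finset.univ fun j _ => hi _ j]
      simp only [dotProduct, mulVec, Pi.star_apply, star_trivial, Finset.mul_sum, Matrix.of_apply,
        integral_const_mul, integral_mul_const]
    rw [this]
    exact integral_nonneg fun ω => sq_nonneg _

/-- An i.i.d. nonlinear regression model `Y = f W₀ Z + ε` with a smooth regression function whose
derivatives with respect to the parameter grow polynomially in the regressor. -/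
structure RegressionModel (P : Measure Ω) (f : EuclideanSpace ℝ ι → X → EuclideanSpace ℝ (Fin d))
    (Y : ℕ → Ω → EuclideanSpace ℝ (Fin d)) (Z : ℕ → Ω → X) (ε : Ω → EuclideanSpace ℝ (Fin d))
    (W₀ : EuclideanSpace ℝ ι) (Γ₀ : Matrix (Fin d) (Fin d) ℝ) : Prop where
  contDiff : ContDiff ℝ 2 (Function.uncurry f)
  bound : ∀ R : ℝ, ∃ C : ℝ, 0 ≤ C ∧ ∀ w, ‖w‖ ≤ R → ∀ z, ‖f w z‖ ≤ C * (1 + ‖z‖) ∧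
    ‖fderiv ℝ (fun v => f v z) w‖ ≤ C * (1 + ‖z‖) ∧
    ‖fderiv ℝ (fderiv ℝ (fun v => f v z)) w‖ ≤ C * (1 + ‖z‖) ^ 2
  measurable_Y : ∀ t, Measurable (Y t)
  measurable_Z : ∀ t, Measurable (Z t)
  indep : iIndepFun (fun t ω => (Y t ω, Z t ω)) P
  ident : ∀ t, IdentDistrib (fun ω => (Y t ω, Z t ω)) (fun ω => (Y 0 ω, Z 0 ω)) P P
  model : ∀ ω, Y 0 ω = f W₀ (Z 0 ω) + ε ω
  indep_noise : IndepFun ε (Z 0) P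
  noise_mean : ∫ ω, ε ω ∂P = 0
  noise_memLp : MemLp ε 2 P
  cov : Γ₀ = covarianceMatrix P ε
  isUnit_cov : IsUnit Γ₀
  memLp_Z : MemLp (Z 0) 3 P

/-- The empirical error covariance matrix at parameter `w`. -/
noncomputable def empOuter (f : EuclideanSpace ℝ ι → X → EuclideanSpace ℝ (Fin d))
    (Y : ℕ → Ω → EuclideanSpace ℝ (Fin d)) (Z : ℕ → Ω → X) (n : ℕ) (ω : Ω)
    (w : EuclideanSpace ℝ ι) : Fin d → Fin d → ℝ :=
  (n : ℝ)⁻¹ • ∑ t ∈ Finset.range n, errorOuter (Y t ω) (f w (Z t ω))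

namespace RegressionModel

variable {P : Measure Ω} [IsProbabilityMeasure P]
  {f : EuclideanSpace ℝ ι → X → EuclideanSpace ℝ (Fin d)}
  {Y : ℕ → Ω → EuclideanSpace ℝ (Fin d)} {Z : ℕ → Ω → X} {ε : Ω → EuclideanSpace ℝ (Fin d)}
  {W₀ : EuclideanSpace ℝ ι} {Γ₀ : Matrix (Fin d) (Fin d) ℝ}

theorem contDiff_left (h : RegressionModel P f Y Z ε W₀ Γ₀) (z : X) :
    ContDiff ℝ 2 fun w => f w z :=
  h.contDiff.comp (contDiff_id.prodMk contDiff_const)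

theorem continuous_right (h : RegressionModel P f Y Z ε W₀ Γ₀) (w : EuclideanSpace ℝ ι) :
    Continuous (f w) :=
  h.contDiff.continuous.comp (by fun_prop : Continuous fun z => (w, z))

theorem memLp_one_add_norm (h : RegressionModel P f Y Z ε W₀ Γ₀) :
    MemLp (fun ω => 1 + ‖Z 0 ω‖) 3 P :=
  (memLp_const (1 : ℝ) : MemLp (fun _ : Ω => (1 : ℝ)) 3 P).add h.memLp_Z.norm

theorem memLp_two_one_add_norm (h : RegressionModel P f Y Z ε W₀ Γ₀) :
    MemLp (fun ω => 1 + ‖Z 0 ω‖) 2 P :=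
  h.memLp_one_add_norm.mono_exponent (by norm_num)

theorem integrable_one_add_norm_cube (h : RegressionModel P f Y Z ε W₀ Γ₀) :
    Integrable (fun ω => (1 + ‖Z 0 ω‖) ^ 3) P := by
  have := h.memLp_one_add_norm.integrable_norm_pow (by norm_num)
  refine this.congr (Eventually.of_forall fun ω => ?_)
  simp only [Real.norm_of_nonneg (show 0 ≤ 1 + ‖Z 0 ω‖ by positivity)]

theorem integrable_one_add_norm_sq (h : RegressionModel P f Y Z ε W₀ Γ₀) :
    Integrable (fun ω => (1 + ‖Z 0 ω‖) ^ 2) P :=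
  h.memLp_two_one_add_norm.integrable_sq

theorem indepFun_comp (h : RegressionModel P f Y Z ε W₀ Γ₀) {φ : EuclideanSpace ℝ (Fin d) → ℝ}
    (hφ : Measurable φ) {ψ : X → ℝ} (hψ : Measurable ψ) :
    IndepFun (fun ω => φ (ε ω)) (fun ω => ψ (Z 0 ω)) P :=
  h.indep_noise.comp hφ hψ

theorem integral_mul_comp (h : RegressionModel P f Y Z ε W₀ Γ₀)
    {φ : EuclideanSpace ℝ (Fin d) → ℝ} (hφ : Measurable φ) {ψ : X → ℝ} (hψ : Measurable ψ) :
    ∫ ω, φ (ε ω) * ψ (Z 0 ω) ∂P = (∫ ω, φ (ε ω) ∂P) * ∫ ω, ψ (Z 0 ω) ∂P :=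
  (h.indepFun_comp hφ hψ).integral_fun_mul_eq_mul_integral
    (hφ.comp_aemeasurable h.noise_memLp.1.aemeasurable).aestronglyMeasurable
    (hψ.comp (h.measurable_Z 0)).aestronglyMeasurable

theorem memLp_noise_coord (h : RegressionModel P f Y Z ε W₀ Γ₀) (i : Fin d) :
    MemLp (fun ω => ε ω i) 2 P :=
  (EuclideanSpace.proj i : _ →L[ℝ] ℝ).comp_memLp' h.noise_memLp

theorem integral_noise_coord (h : RegressionModel P f Y Z ε W₀ Γ₀) (i : Fin d) :
    ∫ ω, ε ω i ∂P = 0 := by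
  have := (EuclideanSpace.proj i : EuclideanSpace ℝ (Fin d) →L[ℝ] ℝ).integral_comp_comm
    (h.noise_memLp.integrable one_le_two)
  rw [h.noise_mean, map_zero] at this
  exact this

theorem cov_apply (h : RegressionModel P f Y Z ε W₀ Γ₀) (i j : Fin d) :
    Γ₀ i j = ∫ ω, ε ω i * ε ω j ∂P := by
  rw [h.cov, covarianceMatrix, Matrix.of_apply, covariance, h.integral_noise_coord i,
    h.integral_noise_coord j]
  simp

theorem posDef_cov (h : RegressionModel P f Y Z ε W₀ Γ₀) : Γ₀.PosDef := by
  refine (PosSemidef.posDef_iff_isUnit ?_).2 h.isUnit_cov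
  have : Γ₀ = Matrix.of fun i j => ∫ ω, ε ω i * ε ω j ∂P := by
    ext i j
    exact h.cov_apply i j
  rw [this]
  exact posSemidef_secondMoment h.memLp_noise_coord

theorem memLp_comp_of_le (h : RegressionModel P f Y Z ε W₀ Γ₀) {ψ : X → ℝ} (hψ : Measurable ψ)
    {C : ℝ} (hC : ∀ z, |ψ z| ≤ C * (1 + ‖z‖)) : MemLp (fun ω => ψ (Z 0 ω)) 2 P := by
  refine (h.memLp_two_one_add_norm.const_mul C).mono'
    (hψ.comp (h.measurable_Z 0)).aestronglyMeasurable (Eventually.of_forall fun ω => hC _)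

theorem integrable_comp_of_le (h : RegressionModel P f Y Z ε W₀ Γ₀) {ψ : X → ℝ}
    (hψ : Measurable ψ) {C : ℝ} (hC : ∀ z, |ψ z| ≤ C * (1 + ‖z‖) ^ 2) :
    Integrable (fun ω => ψ (Z 0 ω)) P := by
  refine (h.integrable_one_add_norm_sq.const_mul C).mono'
    (hψ.comp (h.measurable_Z 0)).aestronglyMeasurable (Eventually.of_forall fun ω => hC _)

theorem integrable_mul_comp (h : RegressionModel P f Y Z ε W₀ Γ₀)
    {φ : EuclideanSpace ℝ (Fin d) → ℝ} (hφ : Measurable φ) {ψ : X → ℝ} (hψ : Measurable ψ)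
    (hφi : Integrable (fun ω => φ (ε ω)) P) (hψi : Integrable (fun ω => ψ (Z 0 ω)) P) :
    Integrable (fun ω => φ (ε ω) * ψ (Z 0 ω)) P :=
  (h.indepFun_comp hφ hψ).integrable_mul hφi hψi

theorem measurable_coord (i : Fin d) : Measurable fun v : EuclideanSpace ℝ (Fin d) => v i := by
  fun_prop

/-- Noise and regressor terms that occur once are centred. -/
theorem integral_noise_mul_comp (h : RegressionModel P f Y Z ε W₀ Γ₀) (i : Fin d) {ψ : X → ℝ}
    (hψ : Measurable ψ) : ∫ ω, ε ω i * ψ (Z 0 ω) ∂P = 0 := by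
  rw [h.integral_mul_comp (measurable_coord i) hψ, h.integral_noise_coord, zero_mul]

theorem integrable_noise_mul_comp (h : RegressionModel P f Y Z ε W₀ Γ₀) (i : Fin d) {ψ : X → ℝ}
    (hψ : Measurable ψ) (hψi : Integrable (fun ω => ψ (Z 0 ω)) P) :
    Integrable (fun ω => ε ω i * ψ (Z 0 ω)) P :=
  h.integrable_mul_comp (measurable_coord i) hψ ((h.memLp_noise_coord i).integrable one_le_two) hψi

theorem noise_eq (h : RegressionModel P f Y Z ε W₀ Γ₀) (ω : Ω) :
    Y 0 ω - f W₀ (Z 0 ω) = ε ω := by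
  rw [h.model, add_sub_cancel_left]

theorem noise_coord_eq (h : RegressionModel P f Y Z ε W₀ Γ₀) (ω : Ω) (i : Fin d) :
    Y 0 ω i - f W₀ (Z 0 ω) i = ε ω i := by
  rw [← h.noise_eq]; rfl

theorem exists_norm_Y_le (h : RegressionModel P f Y Z ε W₀ Γ₀) :
    ∃ C : ℝ, 0 ≤ C ∧ ∀ ω, ‖Y 0 ω‖ ≤ ‖ε ω‖ + C * (1 + ‖Z 0 ω‖) := by
  obtain ⟨C, hC0, hC⟩ := h.bound ‖W₀‖
  refine ⟨C, hC0, fun ω => ?_⟩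
  rw [h.model, add_comm]
  exact (norm_add_le _ _).trans (add_le_add le_rfl (hC _ le_rfl _).1)

theorem memLp_Y (h : RegressionModel P f Y Z ε W₀ Γ₀) : MemLp (Y 0) 2 P := by
  obtain ⟨C, -, hC⟩ := h.exists_norm_Y_le
  exact (h.noise_memLp.norm.add (h.memLp_two_one_add_norm.const_mul C)).mono'
    (h.measurable_Y 0).aestronglyMeasurable (Eventually.of_forall hC)

/-- The noise part is a product of independent integrable factors, so no joint higher moment is
needed; the regression part is where the third moment of Z enters. -/
theorem integrable_norm_Y_mul (h : RegressionModel P f Y Z ε W₀ Γ₀) :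
    Integrable (fun ω => ‖Y 0 ω‖ * (1 + ‖Z 0 ω‖) ^ 2) P := by
  obtain ⟨C, -, hC⟩ := h.exists_norm_Y_le
  have h1 : Integrable (fun ω => ‖ε ω‖ * (1 + ‖Z 0 ω‖) ^ 2) P :=
    h.integrable_mul_comp (φ := fun v => ‖v‖) (ψ := fun z => (1 + ‖z‖) ^ 2) (by fun_prop)
      (by fun_prop) (h.noise_memLp.norm.integrable one_le_two) h.integrable_one_add_norm_sq
  refine (h1.add (h.integrable_one_add_norm_cube.const_mul C)).mono' ?_
    (Eventually.of_forall fun ω => ?_)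
  · have := h.measurable_Y 0
    have := h.measurable_Z 0
    exact (by fun_prop : Measurable _).aestronglyMeasurable
  · rw [Real.norm_of_nonneg (by positivity)]
    calc _ ≤ (‖ε ω‖ + C * (1 + ‖Z 0 ω‖)) * (1 + ‖Z 0 ω‖) ^ 2 := by gcongr; exact hC ω
      _ = _ := by simp only [Pi.add_apply]; ring

theorem measurable_pair (h : RegressionModel P f Y Z ε W₀ Γ₀) (t : ℕ) :
    Measurable fun ω => (Y t ω, Z t ω) :=
  (h.measurable_Y t).prodMk (h.measurable_Z t)

theorem contDiff_errorOuter_uncurry (h : RegressionModel P f Y Z ε W₀ Γ₀) :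
    ContDiff ℝ 2 (Function.uncurry fun (w : EuclideanSpace ℝ ι)
      (x : EuclideanSpace ℝ (Fin d) × X) => errorOuter x.1 (f w x.2)) :=
  contDiff_errorOuter.comp ((contDiff_fst.comp contDiff_snd).prodMk
    (h.contDiff.comp (contDiff_fst.prodMk (contDiff_snd.comp contDiff_snd))))

/-- Uniform convergence of the empirical error covariances. -/
theorem ae_tendstoUniformlyOn_empOuter (h : RegressionModel P f Y Z ε W₀ Γ₀)
    {Θ : Set (EuclideanSpace ℝ ι)} (hΘ : IsCompact Θ) :
    ContinuousOn (fun w => ∫ ω, errorOuter (Y 0 ω) (f w (Z 0 ω)) ∂P) Θ ∧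
    ∀ᵐ ω ∂P, TendstoUniformlyOn (fun n w => empOuter f Y Z n ω w)
      (fun w => ∫ ω, errorOuter (Y 0 ω) (f w (Z 0 ω)) ∂P) atTop Θ := by
  obtain ⟨R, hR⟩ := hΘ.isBounded.exists_norm_le
  obtain ⟨C, hC0, hC⟩ := h.bound R
  refine ae_tendstoUniformlyOn_average hΘ (ξ := fun t ω => (Y t ω, Z t ω))
    (g := fun x => (‖x.1‖ + C * (1 + ‖x.2‖)) ^ 2)
    h.contDiff_errorOuter_uncurry.continuous h.measurable_pair h.indep h.ident
    (fun w hw x => ?_) (h.memLp_Y.norm.add (h.memLp_two_one_add_norm.const_mul C)).integrable_sq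
  refine (norm_errorOuter_le _ _).trans ?_
  gcongr
  exact (norm_sub_le _ _).trans (add_le_add le_rfl (hC w (hR w hw) _).1)

/-- The second derivative consists of products of two first derivatives and of a residual with a
second derivative of f. The growth exponents of `bound` thus lead to the cube of 1 + ‖z‖, the
highest power with a finite mean under the moment assumption. -/
theorem norm_hessian_errorOuter_le (h : RegressionModel P f Y Z ε W₀ Γ₀) (R : ℝ) :
    ∃ C : ℝ, 0 ≤ C ∧ ∀ w, ‖w‖ ≤ R → ∀ (y : EuclideanSpace ℝ (Fin d)) (z : X),
      ‖fderiv ℝ (fderiv ℝ fun v => errorOuter y (f v z)) w‖ ≤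
        C * (‖y‖ * (1 + ‖z‖) ^ 2 + (1 + ‖z‖) ^ 3) := by
  obtain ⟨C, hC0, hC⟩ := h.bound R
  refine ⟨2 * (2 * C ^ 2 + C), by positivity, fun w hw y z => ?_⟩
  obtain ⟨h0, h1, h2⟩ := hC w hw z
  refine (norm_fderiv_fderiv_errorOuter_le (h.contDiff_left z) y w).trans ?_
  have hu : 1 ≤ 1 + ‖z‖ := by linarith [norm_nonneg z]
  calc _ ≤ 2 * ((C * (1 + ‖z‖)) ^ 2 + C * (1 + ‖z‖) ^ 2 * (‖y‖ + C * (1 + ‖z‖))) := by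
        gcongr
        exact (norm_sub_le _ _).trans (add_le_add le_rfl h0)
    _ = 2 * (C ^ 2 * (1 + ‖z‖) ^ 2 + C ^ 2 * (1 + ‖z‖) ^ 3 + C * (‖y‖ * (1 + ‖z‖) ^ 2)) := by ring
    _ ≤ 2 * (C ^ 2 * (1 + ‖z‖) ^ 3 + C ^ 2 * (1 + ‖z‖) ^ 3 + C * (‖y‖ * (1 + ‖z‖) ^ 2)) := by
        gcongr
        · norm_num
    _ ≤ _ := by
        have e1 : 0 ≤ C ^ 2 * (‖y‖ * (1 + ‖z‖) ^ 2) := by positivity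
        have e2 : 0 ≤ C * (1 + ‖z‖) ^ 3 := by positivity
        nlinarith

/-- Uniform convergence of the second derivatives of the empirical error covariances. -/
theorem ae_tendstoUniformlyOn_hessian (h : RegressionModel P f Y Z ε W₀ Γ₀)
    {Θ : Set (EuclideanSpace ℝ ι)} (hΘ : IsCompact Θ) :
    ContinuousOn (fun w => ∫ ω, fderiv ℝ (fderiv ℝ fun v => errorOuter (Y 0 ω) (f v (Z 0 ω))) w ∂P)
      Θ ∧
    ∀ᵐ ω ∂P, TendstoUniformlyOn (fun n w => fderiv ℝ (fderiv ℝ (empOuter f Y Z n ω)) w)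
      (fun w => ∫ ω, fderiv ℝ (fderiv ℝ fun v => errorOuter (Y 0 ω) (f v (Z 0 ω))) w ∂P)
      atTop Θ := by
  obtain ⟨R, hR⟩ := hΘ.isBounded.exists_norm_le
  obtain ⟨C, hC0, hC⟩ := h.norm_hessian_errorOuter_le R
  have hcd : ∀ y z, ContDiff ℝ 2 fun v => errorOuter y (f v z) := fun y z =>
    contDiff_errorOuter.comp (contDiff_const.prodMk (h.contDiff_left z))
  have key := ae_tendstoUniformlyOn_average hΘ (ξ := fun t ω => (Y t ω, Z t ω))
    (q := fun w x => fderiv ℝ (fderiv ℝ fun v => errorOuter x.1 (f v x.2)) w)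
    (g := fun x => C * (‖x.1‖ * (1 + ‖x.2‖) ^ 2 + (1 + ‖x.2‖) ^ 3))
    (continuous_fderiv_fderiv_of_contDiff_uncurry h.contDiff_errorOuter_uncurry).2
    h.measurable_pair h.indep h.ident (fun w hw x => hC w (hR w hw) _ _)
    ((h.integrable_norm_Y_mul.add h.integrable_one_add_norm_cube).const_mul C)
  refine ⟨key.1, key.2.mono fun ω hω => ?_⟩
  have hd1 : ∀ n, fderiv ℝ (empOuter f Y Z n ω) = fun w => (n : ℝ)⁻¹ • ∑ t ∈ Finset.range n,
      fderiv ℝ (fun v => errorOuter (Y t ω) (f v (Z t ω))) w := by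
    intro n
    ext1 w
    refine HasFDerivAt.fderiv ?_
    exact (HasFDerivAt.fun_sum fun t _ =>
      ((hcd _ _).differentiable (by norm_num) w).hasFDerivAt).fun_const_smul _
  have hd2 : ∀ n w, fderiv ℝ (fderiv ℝ (empOuter f Y Z n ω)) w =
      (n : ℝ)⁻¹ • ∑ t ∈ Finset.range n,
        fderiv ℝ (fderiv ℝ fun v => errorOuter (Y t ω) (f v (Z t ω))) w := by
    intro n w
    rw [hd1]
    refine HasFDerivAt.fderiv ?_
    exact (HasFDerivAt.fun_sum fun t _ =>
      (((hcd _ _).fderiv_right (m := 1) (by norm_num)).differentiable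
        (by norm_num) w).hasFDerivAt).fun_const_smul _
  simp only [hd2]
  exact hω

end RegressionModel

end RegressionModel

/-! ### Moment identities at the true parameter: limit covariance, Hessian and score -/

section Moments

set_option maxSynthPendingDepth 3

variable {ι : Type*} [Fintype ι] {d : ℕ}
  {X : Type*} [NormedAddCommGroup X] [NormedSpace ℝ X] [SecondCountableTopology X]
  [MeasurableSpace X] [BorelSpace X] {Ω : Type*} [MeasurableSpace Ω]

/-- The bilinear form `(u, v) ↦ tr (Γ⁻¹ E[(D f u) (D f v)ᵀ])` of a regression model. -/
noncomputable def fisherForm (P : Measure Ω)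
    (f : EuclideanSpace ℝ ι → X → EuclideanSpace ℝ (Fin d)) (Z : Ω → X) (W₀ : EuclideanSpace ℝ ι)
    (Γ : Matrix (Fin d) (Fin d) ℝ) (u v : EuclideanSpace ℝ ι) : ℝ :=
  ∑ i, ∑ j, Γ⁻¹ i j * ∫ ω, fderiv ℝ (fun w => f w (Z ω)) W₀ u j *
    fderiv ℝ (fun w => f w (Z ω)) W₀ v i ∂P

theorem integral_pi_apply {P : Measure Ω} {F : Ω → Fin d → Fin d → ℝ} (hF : Integrable F P)
    (i j : Fin d) : (∫ ω, F ω ∂P) i j = ∫ ω, F ω i j ∂P :=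
  (((ContinuousLinearMap.proj j : (Fin d → ℝ) →L[ℝ] ℝ) ∘L
    (ContinuousLinearMap.proj i : (Fin d → Fin d → ℝ) →L[ℝ] _)).integral_comp_comm hF).symm

namespace RegressionModel

variable {P : Measure Ω} [IsProbabilityMeasure P]
  {f : EuclideanSpace ℝ ι → X → EuclideanSpace ℝ (Fin d)}
  {Y : ℕ → Ω → EuclideanSpace ℝ (Fin d)} {Z : ℕ → Ω → X} {ε : Ω → EuclideanSpace ℝ (Fin d)}
  {W₀ : EuclideanSpace ℝ ι} {Γ₀ : Matrix (Fin d) (Fin d) ℝ}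

theorem memLp_response_coord (h : RegressionModel P f Y Z ε W₀ Γ₀) (w : EuclideanSpace ℝ ι)
    (i : Fin d) : MemLp (fun ω => f w (Z 0 ω) i) 2 P := by
  obtain ⟨C, -, hC⟩ := h.bound ‖w‖
  exact h.memLp_comp_of_le (ψ := fun z => f w z i)
    ((measurable_coord i).comp (h.continuous_right w).measurable)
    fun z => (abs_coord_le_norm _ i).trans (hC w le_rfl z).1

theorem measurable_deriv_coord (h : RegressionModel P f Y Z ε W₀ Γ₀) (v : EuclideanSpace ℝ ι)
    (i : Fin d) : Measurable fun z => fderiv ℝ (fun w => f w z) W₀ v i := by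
  have h1 := (continuous_fderiv_fderiv_of_contDiff_uncurry h.contDiff).1
  have h2 : Continuous fun z => fderiv ℝ (fun w => f w z) W₀ :=
    h1.comp (by fun_prop : Continuous fun z => (W₀, z))
  exact (measurable_coord i).comp (h2.clm_apply continuous_const).measurable

theorem measurable_deriv_deriv_coord (h : RegressionModel P f Y Z ε W₀ Γ₀)
    (u v : EuclideanSpace ℝ ι) (i : Fin d) :
    Measurable fun z => fderiv ℝ (fderiv ℝ fun w => f w z) W₀ u v i := by
  have h1 := (continuous_fderiv_fderiv_of_contDiff_uncurry h.contDiff).2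
  have h2 : Continuous fun z => fderiv ℝ (fderiv ℝ fun w => f w z) W₀ :=
    h1.comp (by fun_prop : Continuous fun z => (W₀, z))
  exact (measurable_coord i).comp
    ((h2.clm_apply continuous_const).clm_apply continuous_const).measurable

theorem memLp_deriv_coord (h : RegressionModel P f Y Z ε W₀ Γ₀) (v : EuclideanSpace ℝ ι)
    (i : Fin d) : MemLp (fun ω => fderiv ℝ (fun w => f w (Z 0 ω)) W₀ v i) 2 P := by
  obtain ⟨C, -, hC⟩ := h.bound ‖W₀‖
  refine h.memLp_comp_of_le (h.measurable_deriv_coord v i) (C := C * ‖v‖) fun z => ?_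
  refine (abs_coord_le_norm _ i).trans ((ContinuousLinearMap.le_opNorm _ _).trans ?_)
  calc _ ≤ C * (1 + ‖z‖) * ‖v‖ := by gcongr; exact (hC W₀ le_rfl z).2.1
    _ = _ := by ring

theorem integrable_deriv_deriv_coord (h : RegressionModel P f Y Z ε W₀ Γ₀)
    (u v : EuclideanSpace ℝ ι) (i : Fin d) :
    Integrable (fun ω => fderiv ℝ (fderiv ℝ fun w => f w (Z 0 ω)) W₀ u v i) P := by
  obtain ⟨C, -, hC⟩ := h.bound ‖W₀‖
  refine h.integrable_comp_of_le (h.measurable_deriv_deriv_coord u v i) (C := C * ‖u‖ * ‖v‖)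
    fun z => ?_
  refine (abs_coord_le_norm _ i).trans ((ContinuousLinearMap.le_opNorm₂ _ _ _).trans ?_)
  calc _ ≤ C * (1 + ‖z‖) ^ 2 * ‖u‖ * ‖v‖ := by gcongr; exact (hC W₀ le_rfl z).2.2
    _ = _ := by ring

theorem integrable_errorOuter (h : RegressionModel P f Y Z ε W₀ Γ₀) (w : EuclideanSpace ℝ ι) :
    Integrable (fun ω => errorOuter (Y 0 ω) (f w (Z 0 ω))) P := by
  obtain ⟨C, -, hC⟩ := h.bound ‖w‖
  refine (h.memLp_Y.norm.add
    (h.memLp_two_one_add_norm.const_mul C)).integrable_sq.mono' ?_ (Eventually.of_forall fun ω => ?_)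
  · have h1 : Continuous fun x : EuclideanSpace ℝ (Fin d) × X => errorOuter x.1 (f w x.2) :=
      h.contDiff_errorOuter_uncurry.continuous.comp (by fun_prop :
        Continuous fun x : EuclideanSpace ℝ (Fin d) × X => (w, x))
    exact (h1.measurable.comp (h.measurable_pair 0)).aestronglyMeasurable
  · refine (norm_errorOuter_le _ _).trans ?_
    simp only [Pi.add_apply]
    gcongr
    exact (norm_sub_le _ _).trans (add_le_add le_rfl (hC w le_rfl _).1)

/-- The limit of the empirical error covariances is `Γ₀` plus the second moment matrix of
`f w Z - f W₀ Z`. -/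
theorem of_integral_errorOuter (h : RegressionModel P f Y Z ε W₀ Γ₀) (w : EuclideanSpace ℝ ι) :
    Matrix.of (∫ ω, errorOuter (Y 0 ω) (f w (Z 0 ω)) ∂P) = Γ₀ + Matrix.of fun i j =>
      ∫ ω, (f w (Z 0 ω) - f W₀ (Z 0 ω)) i * (f w (Z 0 ω) - f W₀ (Z 0 ω)) j ∂P := by
  ext i j
  have hm : ∀ i, Measurable fun z => (f w z - f W₀ z) i := fun i =>
    (measurable_coord i).comp ((h.continuous_right w).sub (h.continuous_right W₀)).measurable
  have hL : ∀ i, MemLp (fun ω => (f w (Z 0 ω) - f W₀ (Z 0 ω)) i) 2 P := fun i =>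
    (h.memLp_response_coord w i).sub (h.memLp_response_coord W₀ i)
  have hi := fun i => (hL i).integrable one_le_two
  rw [Matrix.of_apply, integral_pi_apply (h.integrable_errorOuter w), Matrix.add_apply,
    Matrix.of_apply, h.cov_apply]
  -- The residual is ε - (f w Z - f W₀ Z). In the expanded product every cross term contains the
  -- noise exactly once and so integrates to zero.
  have hpt : ∀ ω, errorOuter (Y 0 ω) (f w (Z 0 ω)) i j =
      (ε ω i * ε ω j + (f w (Z 0 ω) - f W₀ (Z 0 ω)) i * (f w (Z 0 ω) - f W₀ (Z 0 ω)) j) -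
      (ε ω i * (f w (Z 0 ω) - f W₀ (Z 0 ω)) j + ε ω j * (f w (Z 0 ω) - f W₀ (Z 0 ω)) i) := by
    intro ω
    simp only [errorOuter, ← h.noise_coord_eq ω, PiLp.sub_apply]
    ring
  simp_rw [hpt]
  have i1 : Integrable (fun ω => ε ω i * ε ω j) P :=
    (h.memLp_noise_coord i).integrable_mul (h.memLp_noise_coord j)
  have i2 : Integrable (fun ω => (f w (Z 0 ω) - f W₀ (Z 0 ω)) i *
    (f w (Z 0 ω) - f W₀ (Z 0 ω)) j) P := (hL i).integrable_mul (hL j)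
  have i3 := h.integrable_noise_mul_comp i (hm j) (hi j)
  have i4 := h.integrable_noise_mul_comp j (hm i) (hi i)
  rw [integral_sub (by exact i1.add i2) (by exact i3.add i4), integral_add i1 i2,
    integral_add i3 i4, h.integral_noise_mul_comp i (hm j), h.integral_noise_mul_comp j (hm i)]
  ring

theorem posSemidef_bias (h : RegressionModel P f Y Z ε W₀ Γ₀) (w : EuclideanSpace ℝ ι) :
    (Matrix.of fun i j => ∫ ω, (f w (Z 0 ω) - f W₀ (Z 0 ω)) i *
      (f w (Z 0 ω) - f W₀ (Z 0 ω)) j ∂P).PosSemidef :=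
  posSemidef_secondMoment fun i => (h.memLp_response_coord w i).sub (h.memLp_response_coord W₀ i)

theorem of_integral_errorOuter_self (h : RegressionModel P f Y Z ε W₀ Γ₀) :
    Matrix.of (∫ ω, errorOuter (Y 0 ω) (f W₀ (Z 0 ω)) ∂P) = Γ₀ := by
  rw [h.of_integral_errorOuter]
  ext i j
  simp

/-- The diagonal entries suffice: a nonnegative function with zero integral vanishes almost
everywhere. -/
theorem ae_eq_of_bias_eq_zero (h : RegressionModel P f Y Z ε W₀ Γ₀) {w : EuclideanSpace ℝ ι}
    (hw : (Matrix.of fun i j => ∫ ω, (f w (Z 0 ω) - f W₀ (Z 0 ω)) i *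
      (f w (Z 0 ω) - f W₀ (Z 0 ω)) j ∂P) = 0) : ∀ᵐ ω ∂P, f w (Z 0 ω) = f W₀ (Z 0 ω) := by
  have hL : ∀ i, MemLp (fun ω => (f w (Z 0 ω) - f W₀ (Z 0 ω)) i) 2 P := fun i =>
    (h.memLp_response_coord w i).sub (h.memLp_response_coord W₀ i)
  have h0 : ∀ i, ∀ᵐ ω ∂P, (f w (Z 0 ω) - f W₀ (Z 0 ω)) i = 0 := by
    intro i
    have h1 : ∫ ω, (f w (Z 0 ω) - f W₀ (Z 0 ω)) i * (f w (Z 0 ω) - f W₀ (Z 0 ω)) i ∂P = 0 :=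
      congrFun (congrFun hw i) i
    rw [integral_eq_zero_iff_of_nonneg (fun ω => mul_self_nonneg _)
      ((hL i).integrable_mul (hL i))] at h1
    filter_upwards [h1] with ω hω
    exact mul_self_eq_zero.1 hω
  filter_upwards [ae_all_iff.2 h0] with ω hω
  ext i
  exact sub_eq_zero.1 (hω i)

theorem continuous_hessian_errorOuter (h : RegressionModel P f Y Z ε W₀ Γ₀) :
    (Continuous fun x : EuclideanSpace ℝ (Fin d) × X =>
      fderiv ℝ (fun v => errorOuter x.1 (f v x.2)) W₀) ∧
    Continuous fun x : EuclideanSpace ℝ (Fin d) × X =>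
      fderiv ℝ (fderiv ℝ fun v => errorOuter x.1 (f v x.2)) W₀ := by
  have h1 := continuous_fderiv_fderiv_of_contDiff_uncurry h.contDiff_errorOuter_uncurry
  have h2 : Continuous fun x : EuclideanSpace ℝ (Fin d) × X => (W₀, x) := by fun_prop
  exact ⟨h1.1.comp h2, h1.2.comp h2⟩

theorem integrable_hessian_errorOuter (h : RegressionModel P f Y Z ε W₀ Γ₀) :
    Integrable (fun ω => fderiv ℝ (fderiv ℝ fun v => errorOuter (Y 0 ω) (f v (Z 0 ω))) W₀) P := by
  obtain ⟨C, -, hC⟩ := h.norm_hessian_errorOuter_le ‖W₀‖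
  refine ((h.integrable_norm_Y_mul.add h.integrable_one_add_norm_cube).const_mul C).mono' ?_
    (Eventually.of_forall fun ω => hC W₀ le_rfl _ _)
  exact (h.continuous_hessian_errorOuter.2.stronglyMeasurable.comp_measurable
    (h.measurable_pair 0)).aestronglyMeasurable

theorem inv_cov_symm (h : RegressionModel P f Y Z ε W₀ Γ₀) (i j : Fin d) :
    Γ₀⁻¹ i j = Γ₀⁻¹ j i := by
  have := congrFun (congrFun h.posDef_cov.inv.isHermitian i) j
  simpa [Matrix.conjTranspose_apply] using this.symm

/-- The second derivative of the limiting generalised least squares cost at the true parameter. -/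
theorem tracePairing_integral_hessian (h : RegressionModel P f Y Z ε W₀ Γ₀)
    (u v : EuclideanSpace ℝ ι) :
    tracePairing Γ₀⁻¹
      ((∫ ω, fderiv ℝ (fderiv ℝ fun v => errorOuter (Y 0 ω) (f v (Z 0 ω))) W₀ ∂P) u v) =
      2 * fisherForm P f (Z 0) W₀ Γ₀ u v := by
  set D : EuclideanSpace ℝ ι → Ω → EuclideanSpace ℝ (Fin d) :=
    fun v ω => fderiv ℝ (fun w => f w (Z 0 ω)) W₀ v with hD
  have hH := h.integrable_hessian_errorOuter
  have hHu := hH.apply_continuousLinearMap u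
  have hHuv := hHu.apply_continuousLinearMap v
  have hDi : ∀ u v i j, Integrable (fun ω => D u ω i * D v ω j) P := fun u v i j =>
    (h.memLp_deriv_coord u i).integrable_mul (h.memLp_deriv_coord v j)
  have hent : ∀ i j,
      ((∫ ω, fderiv ℝ (fderiv ℝ fun v => errorOuter (Y 0 ω) (f v (Z 0 ω))) W₀ ∂P) u v) i j =
      (∫ ω, D u ω i * D v ω j ∂P) + ∫ ω, D v ω i * D u ω j ∂P := by
    intro i j
    rw [ContinuousLinearMap.integral_apply hH, ContinuousLinearMap.integral_apply hHu,
      integral_pi_apply hHuv]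
    -- At the true parameter the residual is the noise, so the terms with second derivatives of f
    -- integrate to zero and only products of first derivatives survive.
    have hpt : ∀ ω, fderiv ℝ (fderiv ℝ fun v => errorOuter (Y 0 ω) (f v (Z 0 ω))) W₀ u v i j =
        (D u ω i * D v ω j + D v ω i * D u ω j) -
        (ε ω j * fderiv ℝ (fderiv ℝ fun w => f w (Z 0 ω)) W₀ u v i
          + ε ω i * fderiv ℝ (fderiv ℝ fun w => f w (Z 0 ω)) W₀ u v j) := by
      intro ω
      rw [fderiv_fderiv_errorOuter_apply (h.contDiff_left (Z 0 ω)), h.noise_coord_eq,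
        h.noise_coord_eq]
      simp only [hD]
      ring
    simp_rw [hpt]
    have hm := h.measurable_deriv_deriv_coord u v
    have hi := h.integrable_deriv_deriv_coord u v
    have i3 := h.integrable_noise_mul_comp j (hm i) (hi i)
    have i4 := h.integrable_noise_mul_comp i (hm j) (hi j)
    rw [integral_sub (by exact (hDi u v i j).add (hDi v u i j)) (by exact i3.add i4),
      integral_add (hDi u v i j) (hDi v u i j), integral_add i3 i4,
      h.integral_noise_mul_comp j (hm i), h.integral_noise_mul_comp i (hm j)]
    ring
  rw [tracePairing_apply]
  simp only [hent, mul_add, Finset.sum_add_distrib]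
  -- Symmetry of Γ₀⁻¹ makes the two products of first derivatives contribute equally, whence the
  -- factor 2.
  have hswap : ∑ i, ∑ j, Γ₀⁻¹ i j * ∫ ω, D v ω j * D u ω i ∂P =
      ∑ i, ∑ j, Γ₀⁻¹ i j * ∫ ω, D u ω j * D v ω i ∂P := by
    rw [Finset.sum_comm]
    refine Finset.sum_congr rfl fun i _ => Finset.sum_congr rfl fun j _ => ?_
    rw [h.inv_cov_symm j i]
    simp_rw [mul_comm (D v _ i)]
  rw [hswap, two_mul]
  rfl

/-- At W₀ the gradient is bounded by a multiple of ‖ε‖(1 + ‖Z‖), a product of independent square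
integrable variables; independence avoids fourth moments. -/
theorem memLp_gradient_errorOuter (h : RegressionModel P f Y Z ε W₀ Γ₀) :
    MemLp (fun ω => fderiv ℝ (fun v => errorOuter (Y 0 ω) (f v (Z 0 ω))) W₀) 2 P := by
  obtain ⟨C, hC0, hC⟩ := h.bound ‖W₀‖
  have hL : MemLp (fun ω => 2 * (C * (‖ε ω‖ * (1 + ‖Z 0 ω‖)))) 2 P := by
    refine (MemLp.const_mul ?_ C).const_mul 2
    refine (memLp_two_iff_integrable_sq (h.noise_memLp.1.norm.mul
      h.memLp_two_one_add_norm.1)).2 ?_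
    have := h.integrable_mul_comp (φ := fun v => ‖v‖ ^ 2) (ψ := fun z => (1 + ‖z‖) ^ 2)
      (by fun_prop) (by fun_prop) h.noise_memLp.norm.integrable_sq h.integrable_one_add_norm_sq
    refine this.congr (Eventually.of_forall fun ω => ?_)
    simp only [Pi.mul_apply]
    ring
  refine hL.mono' (h.continuous_hessian_errorOuter.1.stronglyMeasurable.comp_measurable
    (h.measurable_pair 0)).aestronglyMeasurable (Eventually.of_forall fun ω => ?_)
  refine (norm_fderiv_errorOuter_le (h.contDiff_left _) _ _).trans ?_
  rw [h.noise_eq]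
  calc _ ≤ 2 * (C * (1 + ‖Z 0 ω‖) * ‖ε ω‖) := by gcongr; exact (hC W₀ le_rfl _).2.1
    _ = _ := by ring

theorem gradient_errorOuter_apply (h : RegressionModel P f Y Z ε W₀ Γ₀) (ω : Ω)
    (v : EuclideanSpace ℝ ι) (i j : Fin d) :
    fderiv ℝ (fun v => errorOuter (Y 0 ω) (f v (Z 0 ω))) W₀ v i j =
      -(ε ω j * fderiv ℝ (fun w => f w (Z 0 ω)) W₀ v i
        + ε ω i * fderiv ℝ (fun w => f w (Z 0 ω)) W₀ v j) := by
  rw [fderiv_errorOuter_apply (h.contDiff_left (Z 0 ω)), h.noise_coord_eq, h.noise_coord_eq]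
  ring

/-- Each term of the gradient contains the noise once, multiplied by a function of Z. -/
theorem integral_gradient_errorOuter (h : RegressionModel P f Y Z ε W₀ Γ₀) :
    ∫ ω, fderiv ℝ (fun v => errorOuter (Y 0 ω) (f v (Z 0 ω))) W₀ ∂P = 0 := by
  have hG := h.memLp_gradient_errorOuter.integrable one_le_two
  ext v i j
  rw [ContinuousLinearMap.integral_apply hG,
    integral_pi_apply (hG.apply_continuousLinearMap v)]
  simp_rw [h.gradient_errorOuter_apply]
  have hm := h.measurable_deriv_coord v
  have hi := fun i => (h.memLp_deriv_coord v i).integrable one_le_two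
  rw [integral_neg, integral_add (h.integrable_noise_mul_comp j (hm i) (hi i))
    (h.integrable_noise_mul_comp i (hm j) (hi j)), h.integral_noise_mul_comp j (hm i),
    h.integral_noise_mul_comp i (hm j)]
  simp

/-- The information identity: the variance of the score is the Fisher form. -/
theorem integral_tracePairing_gradient_sq (h : RegressionModel P f Y Z ε W₀ Γ₀)
    (v : EuclideanSpace ℝ ι) :
    ∫ ω, (-(1 / 2) * tracePairing Γ₀⁻¹
      (fderiv ℝ (fun v => errorOuter (Y 0 ω) (f v (Z 0 ω))) W₀ v)) ^ 2 ∂P =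
      fisherForm P f (Z 0) W₀ Γ₀ v v := by
  set D : X → Fin d → ℝ := fun z i => fderiv ℝ (fun w => f w z) W₀ v i with hD
  -- With c = Γ₀⁻¹ D, where D is the derivative of f in direction v, the score is εᵀ c; the factor
  -- -1/2 compensates the sign and the two equal halves of the gradient.
  set c : X → Fin d → ℝ := fun z i => ∑ j, Γ₀⁻¹ i j * D z j with hc
  have hDm : ∀ i, Measurable fun z => D z i := h.measurable_deriv_coord v
  have hcm : ∀ i, Measurable fun z => c z i := fun i =>
    Finset.measurable_fun_sum _ fun j _ => (hDm j).const_mul _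
  have hDL : ∀ i, MemLp (fun ω => D (Z 0 ω) i) 2 P := h.memLp_deriv_coord v
  have hcL : ∀ i, MemLp (fun ω => c (Z 0 ω) i) 2 P := fun i =>
    memLp_finsetSum _ fun j _ => (hDL j).const_mul _
  have hscore : ∀ ω, -(1 / 2) * tracePairing Γ₀⁻¹
      (fderiv ℝ (fun v => errorOuter (Y 0 ω) (f v (Z 0 ω))) W₀ v) =
      ∑ i, ε ω i * c (Z 0 ω) i := by
    intro ω
    rw [tracePairing_apply]
    simp only [h.gradient_errorOuter_apply, mul_neg, Finset.sum_neg_distrib, mul_add,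
      Finset.sum_add_distrib]
    have e1 : ∑ i, ∑ j, Γ₀⁻¹ i j * (ε ω i * fderiv ℝ (fun w => f w (Z 0 ω)) W₀ v j) =
        ∑ i, ε ω i * c (Z 0 ω) i := by
      simp only [hc, hD, Finset.mul_sum]
      exact Finset.sum_congr rfl fun i _ => Finset.sum_congr rfl fun j _ => by ring
    have e2 : ∑ i, ∑ j, Γ₀⁻¹ i j * (ε ω j * fderiv ℝ (fun w => f w (Z 0 ω)) W₀ v i) =
        ∑ i, ε ω i * c (Z 0 ω) i := by
      rw [← e1, Finset.sum_comm]
      exact Finset.sum_congr rfl fun i _ => Finset.sum_congr rfl fun j _ => by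
        rw [h.inv_cov_symm]
    rw [e1, e2]
    ring
  have hΓc : ∀ z i, ∑ j, Γ₀ i j * c z j = D z i := by
    intro z i
    have : Γ₀ *ᵥ (Γ₀⁻¹ *ᵥ D z) = D z := by
      rw [Matrix.mulVec_mulVec, Matrix.mul_nonsing_inv _
        ((Matrix.isUnit_iff_isUnit_det _).1 h.isUnit_cov), Matrix.one_mulVec]
    exact congrFun this i
  have hsq : ∀ ω, (∑ i, ε ω i * c (Z 0 ω) i) ^ 2 =
      ∑ i, ∑ j, (ε ω i * ε ω j) * (c (Z 0 ω) i * c (Z 0 ω) j) := by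
    intro ω
    simp only [sq, Finset.sum_mul, Finset.mul_sum]
    exact Finset.sum_congr rfl fun i _ => Finset.sum_congr rfl fun j _ => by ring
  have hεm : ∀ i j, Measurable fun v : EuclideanSpace ℝ (Fin d) => v i * v j := fun i j =>
    (measurable_coord i).mul (measurable_coord j)
  have hint : ∀ i j, Integrable (fun ω => (ε ω i * ε ω j) * (c (Z 0 ω) i * c (Z 0 ω) j)) P :=
    fun i j => h.integrable_mul_comp (hεm i j) ((hcm i).mul (hcm j))
      ((h.memLp_noise_coord i).integrable_mul (h.memLp_noise_coord j))
      ((hcL i).integrable_mul (hcL j))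
  simp_rw [hscore, hsq]
  rw [integral_finsetSum _ fun i _ => integrable_finsetSum _ fun j _ => hint i j]
  simp_rw [integral_finsetSum Finset.univ fun j _ => hint _ j]
  -- Independence replaces ε εᵀ by Γ₀. The constant goes back under the integral so that Γ₀ c = D
  -- can collapse the inner sum, leaving E[cᵀ D].
  have hval : ∀ i j, ∫ ω, (ε ω i * ε ω j) * (c (Z 0 ω) i * c (Z 0 ω) j) ∂P =
      ∫ ω, c (Z 0 ω) i * (Γ₀ i j * c (Z 0 ω) j) ∂P := by
    intro i j
    have := h.integral_mul_comp (hεm i j) ((hcm i).mul (hcm j))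
    simp only [Pi.mul_apply] at this
    rw [this, ← h.cov_apply, ← integral_const_mul]
    congr 1
    ext ω
    ring
  have hint2 : ∀ i j, Integrable (fun ω => c (Z 0 ω) i * (Γ₀ i j * c (Z 0 ω) j)) P := fun i j =>
    (hcL i).integrable_mul ((hcL j).const_mul _)
  simp_rw [hval]
  simp_rw [← integral_finsetSum Finset.univ fun j _ => hint2 _ j, ← Finset.mul_sum, hΓc]
  simp only [fisherForm]
  refine Finset.sum_congr rfl fun i _ => ?_
  simp only [hc, Finset.sum_mul]
  have hint3 : ∀ j, Integrable (fun ω => Γ₀⁻¹ i j * D (Z 0 ω) j * D (Z 0 ω) i) P := fun j =>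
    ((hDL j).const_mul (Γ₀⁻¹ i j)).integrable_mul (hDL i)
  rw [integral_finsetSum _ fun j _ => hint3 j]
  refine Finset.sum_congr rfl fun j _ => ?_
  rw [← integral_const_mul]
  congr 1
  ext ω
  simp only [hD]
  ring

end RegressionModel

end Moments

/-! ### Asymptotic normality of consistent weighted least squares estimators -/

section AsymptoticNormality

set_option maxSynthPendingDepth 3

variable {ι : Type*} [Fintype ι] [DecidableEq ι]

/-- The vector `J φ` for a linear form `φ`, identified with its coordinates. -/
noncomputable def mulVecDual (J : Matrix ι ι ℝ) :
    (EuclideanSpace ℝ ι →L[ℝ] ℝ) →L[ℝ] EuclideanSpace ℝ ι :=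
  LinearMap.toContinuousLinearMap
    { toFun := fun φ => WithLp.toLp 2 (J *ᵥ fun k => φ (EuclideanSpace.single k 1))
      map_add' := fun φ ψ => by
        rw [← WithLp.toLp_add, ← Matrix.mulVec_add]
        rfl
      map_smul' := fun c φ => by
        rw [RingHom.id_apply, ← WithLp.toLp_smul, ← Matrix.mulVec_smul]
        rfl }

theorem mulVecDual_apply (J : Matrix ι ι ℝ) (φ : EuclideanSpace ℝ ι →L[ℝ] ℝ) :
    mulVecDual J φ = WithLp.toLp 2 (J *ᵥ fun k => φ (EuclideanSpace.single k 1)) := rfl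

theorem clm_apply_eq_dotProduct (φ : EuclideanSpace ℝ ι →L[ℝ] ℝ) (u : EuclideanSpace ℝ ι) :
    φ u = (fun k => φ (EuclideanSpace.single k 1)) ⬝ᵥ u.ofLp := by
  conv_lhs => rw [← (EuclideanSpace.basisFun ι ℝ).sum_repr u]
  simp [dotProduct, mul_comm]

theorem inner_mulVecDual {J : Matrix ι ι ℝ} (hJ : Jᵀ = J) (φ : EuclideanSpace ℝ ι →L[ℝ] ℝ)
    (u : EuclideanSpace ℝ ι) :
    inner ℝ (mulVecDual J φ) u = φ (WithLp.toLp 2 (J *ᵥ u.ofLp)) := by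
  rw [clm_apply_eq_dotProduct φ, Matrix.dotProduct_mulVec, ← Matrix.mulVec_transpose, hJ,
    EuclideanSpace.inner_eq_star_dotProduct, mulVecDual_apply]
  simp [dotProduct_comm]

/-- This inverts the Hessian: `mulVecDual J⁻¹` recovers u from the linear form that J attaches to
it. -/
theorem mulVecDual_inv_eq {J : Matrix ι ι ℝ} (hJ : J.PosDef) {φ : EuclideanSpace ℝ ι →L[ℝ] ℝ}
    {u : EuclideanSpace ℝ ι} {c : ℝ} (h : ∀ v : EuclideanSpace ℝ ι, φ v = c * (u.ofLp ⬝ᵥ J *ᵥ v.ofLp)) :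
    mulVecDual J⁻¹ φ = c • u := by
  have hJt : Jᵀ = J := by simpa using hJ.isHermitian.eq
  refine ext_inner_right ℝ fun v => ?_
  rw [inner_mulVecDual (by rw [Matrix.transpose_nonsing_inv, hJt]), h, Matrix.mulVec_mulVec,
    Matrix.mul_nonsing_inv _ ((Matrix.isUnit_iff_isUnit_det _).1 hJ.isUnit), Matrix.one_mulVec,
    inner_smul_left, EuclideanSpace.inner_eq_star_dotProduct]
  simp [dotProduct_comm]

variable {d : ℕ}
  {X : Type*} [NormedAddCommGroup X] [NormedSpace ℝ X] [SecondCountableTopology X]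
  [MeasurableSpace X] [BorelSpace X] {Ω : Type*} [MeasurableSpace Ω]
  {P : Measure Ω} [IsProbabilityMeasure P]
  {f : EuclideanSpace ℝ ι → X → EuclideanSpace ℝ (Fin d)}
  {Y : ℕ → Ω → EuclideanSpace ℝ (Fin d)} {Z : ℕ → Ω → X} {ε : Ω → EuclideanSpace ℝ (Fin d)}
  {W₀ : EuclideanSpace ℝ ι} {Γ₀ : Matrix (Fin d) (Fin d) ℝ}

namespace RegressionModel

theorem contDiff_empOuter (h : RegressionModel P f Y Z ε W₀ Γ₀) (n : ℕ) (ω : Ω) :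
    ContDiff ℝ 2 (empOuter f Y Z n ω) := by
  unfold empOuter
  exact (ContDiff.sum fun t _ =>
    contDiff_errorOuter.comp (contDiff_const.prodMk (h.contDiff_left (Z t ω)))).const_smul _

theorem fderiv_empOuter (h : RegressionModel P f Y Z ε W₀ Γ₀) (n : ℕ) (ω : Ω)
    (w : EuclideanSpace ℝ ι) :
    fderiv ℝ (empOuter f Y Z n ω) w = (n : ℝ)⁻¹ • ∑ t ∈ Finset.range n,
      fderiv ℝ (fun v => errorOuter (Y t ω) (f v (Z t ω))) w := by
  have hcd : ∀ y z, ContDiff ℝ 2 fun v => errorOuter y (f v z) := fun y z =>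
    contDiff_errorOuter.comp (contDiff_const.prodMk (h.contDiff_left z))
  exact ((HasFDerivAt.fun_sum fun t _ =>
      ((hcd _ _).differentiable (by norm_num) w).hasFDerivAt).fun_const_smul _).fderiv

/-- Consistent minimisers of generalised least squares costs with a consistent weight matrix are
asymptotically normal with the covariance of the optimally weighted estimator. -/
theorem tendstoInDistribution_of_isMinOn (h : RegressionModel P f Y Z ε W₀ Γ₀)
    {Θ : Set (EuclideanSpace ℝ ι)} (hΘ : IsCompact Θ) (hW₀ : W₀ ∈ interior Θ) {I₀ : Matrix ι ι ℝ}
    (hI₀ : I₀.PosDef)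
    (hI : ∀ u v : EuclideanSpace ℝ ι, u.ofLp ⬝ᵥ I₀ *ᵥ v.ofLp = fisherForm P f (Z 0) W₀ Γ₀ u v)
    {M : ℕ → Ω → Matrix (Fin d) (Fin d) ℝ} {w : ℕ → Ω → EuclideanSpace ℝ ι}
    (hwm : ∀ n, AEMeasurable (w n) P)
    (hw : ∀ᵐ ω ∂P, Tendsto (fun n => w n ω) atTop (𝓝 W₀) ∧
      Tendsto (fun n => M n ω) atTop (𝓝 Γ₀⁻¹) ∧
      ∀ᶠ n in atTop, IsMinOn (fun v => tracePairing (M n ω) (empOuter f Y Z n ω v)) Θ (w n ω)) :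
    TendstoInDistribution (fun (n : ℕ) ω => √(n : ℝ) • (w n ω - W₀)) atTop id (fun _ => P)
      (multivariateGaussian 0 I₀⁻¹) := by
  have hunitI : IsUnit I₀.det := (Matrix.isUnit_iff_isUnit_det _).1 hI₀.isUnit
  have hIt : I₀⁻¹ᵀ = I₀⁻¹ := by simpa using hI₀.inv.isHermitian.eq
  set κ := mulVecDual I₀⁻¹ with hκ
  set L : (Fin d → Fin d → ℝ) →L[ℝ] ℝ := tracePairing Γ₀⁻¹ with hL
  set B : EuclideanSpace ℝ (Fin d) × X → EuclideanSpace ℝ ι →L[ℝ] (Fin d → Fin d → ℝ) :=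
    fun x => fderiv ℝ (fun v => errorOuter x.1 (f v x.2)) W₀ with hB
  have hBc : Continuous B := h.continuous_hessian_errorOuter.1
  -- T is the Newton step -(2 I₀)⁻¹ L∘b associated with a derivative b of the empirical covariance,
  -- since the limiting Hessian of the cost is 2 I₀.
  let T : (EuclideanSpace ℝ ι →L[ℝ] (Fin d → Fin d → ℝ)) →L[ℝ] EuclideanSpace ℝ ι :=
    κ ∘L (-(1 / 2 : ℝ) • ContinuousLinearMap.compL ℝ (EuclideanSpace ℝ ι) (Fin d → Fin d → ℝ) ℝ L)
  have hT : ∀ b, T b = κ (-(1 / 2 : ℝ) • (L ∘L b)) := fun b => rfl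
  have hTinner : ∀ b u, inner ℝ (T b) u =
      -(1 / 2) * L (b (WithLp.toLp 2 (I₀⁻¹ *ᵥ u.ofLp))) := by
    intro b u
    rw [hT, hκ, inner_mulVecDual hIt]
    rfl
  set H : EuclideanSpace ℝ ι →
      EuclideanSpace ℝ ι →L[ℝ] EuclideanSpace ℝ ι →L[ℝ] (Fin d → Fin d → ℝ) := fun w =>
    ∫ ω, fderiv ℝ (fderiv ℝ fun v => errorOuter (Y 0 ω) (f v (Z 0 ω))) w ∂P with hH
  have hHess : ∀ u, κ (L ∘L H W₀ u) = (2 : ℝ) • u := fun u =>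
    mulVecDual_inv_eq hI₀ fun v => by
      rw [hI]
      exact h.tracePairing_integral_hessian u v
  -- the central limit theorem for the scores
  have hBind : iIndepFun (fun t ω => B (Y t ω, Z t ω)) P :=
    h.indep.comp (fun _ => B) fun _ => hBc.measurable
  have hBid : ∀ t, IdentDistrib (fun ω => B (Y t ω, Z t ω)) (fun ω => B (Y 0 ω, Z 0 ω)) P P :=
    fun t => (h.ident t).comp hBc.measurable
  have hBL : MemLp (fun ω => B (Y 0 ω, Z 0 ω)) 2 P := h.memLp_gradient_errorOuter
  have hB0 : ∫ ω, B (Y 0 ω, Z 0 ω) ∂P = 0 := h.integral_gradient_errorOuter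
  have hTm : Measurable T := T.continuous.measurable
  have hclt : TendstoInDistribution
      (fun (n : ℕ) ω => (√(n : ℝ))⁻¹ • ∑ t ∈ Finset.range n, T (B (Y t ω, Z t ω))) atTop id
      (fun _ => P) (multivariateGaussian 0 I₀⁻¹) := by
    refine tendstoInDistribution_inv_sqrt_smul_sum (hBind.comp (fun _ => T) fun _ => hTm)
      (fun t => (hBid t).comp hTm) (T.comp_memLp' hBL) ?_ hI₀.inv.posSemidef fun u => ?_
    · change ∫ ω, T (B (Y 0 ω, Z 0 ω)) ∂P = 0
      rw [T.integral_comp_comm (hBL.integrable one_le_two), hB0, map_zero]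
    · simp only [Function.comp_apply, hTinner]
      -- The information identity in the direction I₀⁻¹u gives (I₀⁻¹u)ᵀ I₀ (I₀⁻¹u) = uᵀ I₀⁻¹ u.
      refine (h.integral_tracePairing_gradient_sq _).trans ?_
      rw [← hI, Matrix.mulVec_mulVec, Matrix.mul_nonsing_inv _ hunitI, Matrix.one_mulVec,
        dotProduct_comm]
  -- the remainder is negligible
  obtain ⟨K, hK⟩ := exists_integral_norm_sq_inv_sqrt_smul_sum_le hBind hBid hBL hB0
  have hsqrt : ∀ n : ℕ, √(n : ℝ) * (n : ℝ)⁻¹ = (√(n : ℝ))⁻¹ := by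
    intro n
    rcases Nat.eq_zero_or_pos n with rfl | hn
    · simp
    · have h1 : √(n : ℝ) ≠ 0 := by positivity
      have h2 : (n : ℝ) = √(n : ℝ) * √(n : ℝ) := (Real.mul_self_sqrt (Nat.cast_nonneg n)).symm
      conv_lhs => rw [h2]
      rw [Real.sqrt_mul_self (Real.sqrt_nonneg _)]
      field_simp
  have hR : ∀ (n : ℕ) ω, (√(n : ℝ))⁻¹ • ∑ t ∈ Finset.range n, B (Y t ω, Z t ω) =
      √(n : ℝ) • fderiv ℝ (empOuter f Y Z n ω) W₀ := by
    intro n ω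
    rw [h.fderiv_empOuter, smul_smul, hsqrt]
  have hwm' : ∀ n : ℕ, AEMeasurable (fun ω => √(n : ℝ) • (w n ω - W₀)) P := fun n =>
    ((hwm n).sub_const W₀).fun_const_smul _
  -- Slutsky: only the difference from the linearised estimator has to vanish in probability.
  refine tendstoInDistribution_of_tendstoInMeasure_sub _ id hclt ?_ hwm'
  refine tendstoInMeasure_zero_of_ae_le_mul (R := fun n ω =>
    (√(n : ℝ))⁻¹ • ∑ t ∈ Finset.range n, B (Y t ω, Z t ω))
    (fun n => ((hwm' n).sub (hclt.forall_aemeasurable n)).aestronglyMeasurable)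
    (fun n => by
      exact (memLp_finsetSum (Finset.range n) fun t _ =>
        (hBid t).memLp_iff.2 hBL).const_smul (√(n : ℝ))⁻¹) hK ?_
  obtain ⟨hHc, hHu⟩ := h.ae_tendstoUniformlyOn_hessian hΘ
  filter_upwards [hHu, hw] with ω hHω ⟨hwω, hMω, hminω⟩ e he
  have hMω' : Tendsto (fun n => tracePairing (M n ω)) atTop (𝓝 L) :=
    (continuous_tracePairing.tendsto _).comp hMω
  -- Coercivity of the limiting Hessian, read off from its left inverse κ/2.
  have hc : ∀ u, ‖u‖ ≤ ‖κ‖ * ‖L ∘L H W₀ u‖ := by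
    intro u
    have h1 : ‖(2 : ℝ) • u‖ ≤ ‖κ‖ * ‖L ∘L H W₀ u‖ := by
      rw [← hHess]
      exact κ.le_opNorm _
    rw [norm_smul, Real.norm_two] at h1
    linarith [norm_nonneg u]
  -- The tolerance is divided by ‖κ‖ because κ is applied to the remainder; adding 1 keeps the
  -- divisor positive.
  set e' : ℝ := e / (‖κ‖ + 1) with he'
  have hκ1 : 0 < ‖κ‖ + 1 := by positivity
  filter_upwards [norm_hessian_sub_add_le_of_isMinOn hW₀ (fun n => h.contDiff_empOuter n ω) hHc hHω
    hMω' hwω hminω hc (div_pos he hκ1)] with n hn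
  set b := fderiv ℝ (empOuter f Y Z n ω) W₀ with hb
  have hX : √(n : ℝ) • (w n ω - W₀) -
      (√(n : ℝ))⁻¹ • ∑ t ∈ Finset.range n, T (B (Y t ω, Z t ω)) =
      √(n : ℝ) • ((1 / 2 : ℝ) • κ (L ∘L (H W₀ (w n ω - W₀)) + L ∘L b)) := by
    rw [← map_sum, ← map_smul T, hR, map_smul T, ← smul_sub, hT, map_add κ, hHess, map_smul κ,
      smul_add, smul_smul]
    norm_num
    rfl
  change ‖√(n : ℝ) • (w n ω - W₀) -
      (√(n : ℝ))⁻¹ • ∑ t ∈ Finset.range n, T (B (Y t ω, Z t ω))‖ ≤ _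
  rw [hX, hR, norm_smul, norm_smul, norm_smul]
  have hκb : ‖κ (L ∘L (H W₀ (w n ω - W₀)) + L ∘L b)‖ ≤ e * ‖b‖ := by
    calc _ ≤ ‖κ‖ * (e' * ‖b‖) := (κ.le_opNorm _).trans (by gcongr)
      _ ≤ (‖κ‖ + 1) * (e' * ‖b‖) := by
        gcongr
        linarith
      _ = e * ‖b‖ := by rw [he']; field_simp
  calc _ ≤ ‖√(n : ℝ)‖ * (1 * (e * ‖b‖)) := by
        gcongr
        norm_num
    _ = _ := by ring

end RegressionModel

end AsymptoticNormality

/-! ### Consistency and limit laws of the two estimators -/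

section Estimators

variable {ι : Type*} [Fintype ι] [DecidableEq ι] {d : ℕ}
  {X : Type*} [NormedAddCommGroup X] [NormedSpace ℝ X] [SecondCountableTopology X]
  [MeasurableSpace X] [BorelSpace X] {Ω : Type*} [MeasurableSpace Ω]
  {P : Measure Ω} [IsProbabilityMeasure P]
  {f : EuclideanSpace ℝ ι → X → EuclideanSpace ℝ (Fin d)}
  {Y : ℕ → Ω → EuclideanSpace ℝ (Fin d)} {Z : ℕ → Ω → X} {ε : Ω → EuclideanSpace ℝ (Fin d)}
  {W₀ : EuclideanSpace ℝ ι} {Γ₀ : Matrix (Fin d) (Fin d) ℝ}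

theorem posSemidef_errorOuter (y o : EuclideanSpace ℝ (Fin d)) :
    (Matrix.of (errorOuter y o)).PosSemidef := by
  have := posSemidef_vecMulVec_self_star fun i => y i - o i
  simp only [star_trivial] at this
  exact this

theorem posSemidef_empOuter (f : EuclideanSpace ℝ ι → X → EuclideanSpace ℝ (Fin d))
    (Y : ℕ → Ω → EuclideanSpace ℝ (Fin d)) (Z : ℕ → Ω → X) (n : ℕ) (ω : Ω)
    (w : EuclideanSpace ℝ ι) : (Matrix.of (empOuter f Y Z n ω w)).PosSemidef := by
  have h1 : (∑ t ∈ Finset.range n, Matrix.of (errorOuter (Y t ω) (f w (Z t ω)))).PosSemidef :=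
    posSemidef_sum _ fun t _ => posSemidef_errorOuter _ _
  have h2 := h1.smul (inv_nonneg.2 (Nat.cast_nonneg (α := ℝ) n))
  convert h2 using 1
  ext i j
  simp [empOuter, Matrix.sum_apply]

namespace RegressionModel

/-- Asymptotic normality of the generalised least squares estimator. -/
theorem tendstoInDistribution_gls (h : RegressionModel P f Y Z ε W₀ Γ₀)
    {Θ : Set (EuclideanSpace ℝ ι)} (hΘ : IsCompact Θ) (hW₀ : W₀ ∈ interior Θ)
    (hident : ∀ w ∈ Θ, (∀ᵐ ω ∂P, f w (Z 0 ω) = f W₀ (Z 0 ω)) → w = W₀) {I₀ : Matrix ι ι ℝ}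
    (hI₀ : I₀.PosDef)
    (hI : ∀ u v : EuclideanSpace ℝ ι, u.ofLp ⬝ᵥ I₀ *ᵥ v.ofLp = fisherForm P f (Z 0) W₀ Γ₀ u v)
    {w : ℕ → Ω → EuclideanSpace ℝ ι} (hwm : ∀ n, AEMeasurable (w n) P)
    (hw : ∀ n, ∀ᵐ ω ∂P, w n ω ∈ Θ ∧
      IsMinOn (fun v => tracePairing Γ₀⁻¹ (empOuter f Y Z n ω v)) Θ (w n ω)) :
    TendstoInDistribution (fun (n : ℕ) ω => √(n : ℝ) • (w n ω - W₀)) atTop id (fun _ => P)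
      (multivariateGaussian 0 I₀⁻¹) := by
  refine h.tendstoInDistribution_of_isMinOn hΘ hW₀ hI₀ hI (M := fun _ _ => Γ₀⁻¹) hwm ?_
  obtain ⟨hSc, hSu⟩ := h.ae_tendstoUniformlyOn_empOuter hΘ
  filter_upwards [hSu, ae_all_iff.2 hw] with ω hSω hwω
  refine ⟨?_, tendsto_const_nhds, Eventually.of_forall fun n => (hwω n).2⟩
  refine tendsto_of_isMinOn_of_tendstoUniformlyOn hΘ hSω hSc (tracePairing Γ₀⁻¹).continuous
    (interior_subset hW₀) (fun v hv hle => hident v hv (h.ae_eq_of_bias_eq_zero ?_))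
    (fun n => (hwω n).1) fun n => (hwω n).2
  -- The limiting cost is tr(Γ₀⁻¹Γ₀) + tr(Γ₀⁻¹B), with B the bias matrix, so being no worse than W₀
  -- means tr(Γ₀⁻¹B) ≤ 0.
  refine h.posDef_cov.inv.eq_zero_of_trace_mul_nonpos (h.posSemidef_bias v) ?_
  rw [tracePairing_eq_trace, tracePairing_eq_trace, h.of_integral_errorOuter_self,
    h.of_integral_errorOuter, Matrix.mul_add, Matrix.trace_add] at hle
  linarith

/-- Asymptotic normality of the minimiser of the determinant of the empirical error covariance. -/
theorem tendstoInDistribution_det (h : RegressionModel P f Y Z ε W₀ Γ₀)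
    {Θ : Set (EuclideanSpace ℝ ι)} (hΘ : IsCompact Θ) (hW₀ : W₀ ∈ interior Θ)
    (hident : ∀ w ∈ Θ, (∀ᵐ ω ∂P, f w (Z 0 ω) = f W₀ (Z 0 ω)) → w = W₀) {I₀ : Matrix ι ι ℝ}
    (hI₀ : I₀.PosDef)
    (hI : ∀ u v : EuclideanSpace ℝ ι, u.ofLp ⬝ᵥ I₀ *ᵥ v.ofLp = fisherForm P f (Z 0) W₀ Γ₀ u v)
    {w : ℕ → Ω → EuclideanSpace ℝ ι} (hwm : ∀ n, AEMeasurable (w n) P)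
    (hw : ∀ n, ∀ᵐ ω ∂P, w n ω ∈ Θ ∧
      IsMinOn (fun v => (Matrix.of (empOuter f Y Z n ω v)).det) Θ (w n ω)) :
    TendstoInDistribution (fun (n : ℕ) ω => √(n : ℝ) • (w n ω - W₀)) atTop id (fun _ => P)
      (multivariateGaussian 0 I₀⁻¹) := by
  -- The weight depends on the estimator itself; this is harmless because the expansion is pathwise
  -- and only needs the weights to converge.
  refine h.tendstoInDistribution_of_isMinOn hΘ hW₀ hI₀ hI
    (M := fun n ω => (Matrix.of (empOuter f Y Z n ω (w n ω)))⁻¹) hwm ?_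
  obtain ⟨hSc, hSu⟩ := h.ae_tendstoUniformlyOn_empOuter hΘ
  have hof : Continuous (Matrix.of : (Fin d → Fin d → ℝ) → Matrix (Fin d) (Fin d) ℝ) :=
    continuous_id
  have hdet : Continuous fun S : Fin d → Fin d → ℝ => (Matrix.of S).det := hof.matrix_det
  have hpos := h.posDef_cov.det_pos
  filter_upwards [hSu, ae_all_iff.2 hw] with ω hSω hwω
  have hcons : Tendsto (fun n => w n ω) atTop (𝓝 W₀) := by
    refine tendsto_of_isMinOn_of_tendstoUniformlyOn hΘ hSω hSc hdet
      (interior_subset hW₀) (fun v hv hle => hident v hv (h.ae_eq_of_bias_eq_zero ?_))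
      (fun n => (hwω n).1) fun n => (hwω n).2
    refine h.posDef_cov.eq_zero_of_det_add_le (h.posSemidef_bias v) ?_
    rwa [h.of_integral_errorOuter_self, h.of_integral_errorOuter] at hle
  have hlim : Tendsto (fun n => Matrix.of (empOuter f Y Z n ω (w n ω))) atTop (𝓝 Γ₀) := by
    have h1 := (hof.tendsto _).comp (hSω.tendsto_comp (hSc W₀ (interior_subset hW₀))
      (tendsto_nhdsWithin_iff.2 ⟨hcons, Eventually.of_forall fun n => (hwω n).1⟩))
    rwa [h.of_integral_errorOuter_self] at h1
  have hinv : ContinuousAt (Inv.inv : Matrix (Fin d) (Fin d) ℝ → _) Γ₀ := by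
    refine continuousAt_matrix_inv Γ₀ ?_
    rw [Ring.inverse_eq_inv']
    exact continuousAt_inv₀ hpos.ne'
  have hdlim : Tendsto (fun n => (Matrix.of (empOuter f Y Z n ω (w n ω))).det) atTop
      (𝓝 Γ₀.det) := (continuous_id.matrix_det.tendsto Γ₀).comp hlim
  refine ⟨hcons, hinv.tendsto.comp hlim, ?_⟩
  -- Minimality for the weighted cost is only claimed for large n: for small n the empirical
  -- covariance can be singular and its inverse is then no valid weight.
  filter_upwards [hdlim.eventually (lt_mem_nhds hpos)] with n hn v hv
  have hpd := (posSemidef_empOuter f Y Z n ω (w n ω)).posDef_iff_det_ne_zero.2 hn.ne'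
  simp only [Set.mem_ofPred_eq, tracePairing_eq_trace]
  exact hpd.trace_inv_mul_le_of_det_le (posSemidef_empOuter f Y Z n ω v) ((hwω n).2 hv)

end RegressionModel

end Estimators

/-! ### Growth in the input of functions of parameters and inputs -/

section ParamGrowth

variable {E X G G' : Type*} [NormedAddCommGroup E] [NormedSpace ℝ E] [NormedAddCommGroup X]
  [NormedSpace ℝ X] [NormedAddCommGroup G] [NormedSpace ℝ G] [NormedAddCommGroup G']
  [NormedSpace ℝ G']

/-- A `C²` function of a parameter and an input that, with its parameter derivatives up to order
two, grows polynomially in the input, locally uniformly in the parameter. -/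
structure ParamGrowth (q : E → X → G) : Prop where
  contDiff : ContDiff ℝ 2 (Function.uncurry q)
  -- The exponents are 1, 1, 2 for orders 0, 1, 2: values grow at most linearly, and each derivative
  -- in the weights can bring out one factor of the size of the input.
  bound : ∀ R : ℝ, ∃ C : ℝ, 0 ≤ C ∧ ∀ w, ‖w‖ ≤ R → ∀ z, ∀ n ≤ 2,
    ‖iteratedFDeriv ℝ n (fun v => q v z) w‖ ≤ C * (1 + ‖z‖) ^ max n 1

namespace ParamGrowth

theorem contDiff_left {q : E → X → G} (h : ParamGrowth q) (z : X) :
    ContDiff ℝ 2 fun w => q w z :=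
  h.contDiff.comp (contDiff_id.prodMk contDiff_const)

theorem exists_norm_iteratedFDeriv_le [ProperSpace E] {b : E → G} (hb : ContDiff ℝ 2 b) (R : ℝ) :
    ∃ C : ℝ, 0 ≤ C ∧ ∀ w, ‖w‖ ≤ R → ∀ n ≤ 2, ‖iteratedFDeriv ℝ n b w‖ ≤ C := by
  have h1 : ∀ n : ℕ, n ≤ 2 → ∃ C, ∀ w ∈ Metric.closedBall (0 : E) R,
      ‖iteratedFDeriv ℝ n b w‖ ≤ C := fun n hn =>
    (isCompact_closedBall (0 : E) R).exists_bound_of_continuousOn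
      (hb.continuous_iteratedFDeriv (by exact_mod_cast hn)).continuousOn
  obtain ⟨C₀, h₀⟩ := h1 0 (by norm_num)
  obtain ⟨C₁, h₁⟩ := h1 1 (by norm_num)
  obtain ⟨C₂, h₂⟩ := h1 2 (by norm_num)
  refine ⟨|C₀| + |C₁| + |C₂|, by positivity, fun w hw n hn => ?_⟩
  have hw' : w ∈ Metric.closedBall (0 : E) R := by simpa using hw
  have e0 := (h₀ w hw').trans (le_abs_self _)
  have e1 := (h₁ w hw').trans (le_abs_self _)
  have e2 := (h₂ w hw').trans (le_abs_self _)
  interval_cases n <;> linarith [abs_nonneg C₀, abs_nonneg C₁, abs_nonneg C₂]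

theorem param [ProperSpace E] {b : E → G} (hb : ContDiff ℝ 2 b) :
    ParamGrowth fun (w : E) (_ : X) => b w where
  contDiff := hb.comp contDiff_fst
  bound R := by
    obtain ⟨C, hC0, hC⟩ := exists_norm_iteratedFDeriv_le hb R
    refine ⟨C, hC0, fun w hw z n hn => (hC w hw n hn).trans (le_mul_of_one_le_right hC0 ?_)⟩
    exact one_le_pow₀ (by linarith [norm_nonneg z])

theorem input (L : X →L[ℝ] G) : ParamGrowth fun (_ : E) (z : X) => L z where
  contDiff := L.contDiff.comp contDiff_snd
  bound R := by
    refine ⟨‖L‖, norm_nonneg _, fun w _ z n _ => ?_⟩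
    rcases Nat.eq_zero_or_pos n with rfl | hn
    · rw [norm_iteratedFDeriv_zero]
      refine (L.le_opNorm z).trans ?_
      simp only [zero_le, sup_of_le_right, pow_one]
      gcongr
      linarith
    · rw [iteratedFDeriv_const_of_ne hn.ne']
      simp only [Pi.zero_apply, norm_zero]
      positivity

theorem add {q r : E → X → G} (hq : ParamGrowth q) (hr : ParamGrowth r) :
    ParamGrowth fun w z => q w z + r w z where
  contDiff := hq.contDiff.add hr.contDiff
  bound R := by
    obtain ⟨C, hC0, hC⟩ := hq.bound R
    obtain ⟨D, hD0, hD⟩ := hr.bound R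
    refine ⟨C + D, by positivity, fun w hw z n hn => ?_⟩
    have hn' : ((n : ℕ) : WithTop ℕ∞) ≤ 2 := by exact_mod_cast hn
    rw [fun_iteratedFDeriv_add_apply ((hq.contDiff_left z).of_le hn').contDiffAt
      ((hr.contDiff_left z).of_le hn').contDiffAt, add_mul]
    exact (norm_add_le _ _).trans (add_le_add (hC w hw z n hn) (hD w hw z n hn))

theorem sum {α : Type*} (s : Finset α) {q : α → E → X → G} (hq : ∀ a ∈ s, ParamGrowth (q a)) :
    ParamGrowth fun w z => ∑ a ∈ s, q a w z := by
  classical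
  induction s using Finset.induction_on with
  | empty =>
    simp only [Finset.sum_empty]
    exact input (0 : X →L[ℝ] G)
  | insert a s ha ih =>
    simp only [Finset.sum_insert ha]
    exact (hq a (Finset.mem_insert_self _ _)).add
      (ih fun b hb => hq b (Finset.mem_insert_of_mem hb))

theorem clm_comp (L : G →L[ℝ] G') {q : E → X → G} (hq : ParamGrowth q) :
    ParamGrowth fun w z => L (q w z) where
  contDiff := L.contDiff.comp hq.contDiff
  bound R := by
    obtain ⟨C, hC0, hC⟩ := hq.bound R
    refine ⟨‖L‖ * C, by positivity, fun w hw z n hn => ?_⟩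
    refine (L.norm_iteratedFDeriv_comp_left (hq.contDiff_left z).contDiffAt
      (by exact_mod_cast hn)).trans ?_
    rw [mul_assoc]
    gcongr
    exact hC w hw z n hn

/-- By Leibniz' rule, and since b does not involve the input and is bounded with its derivatives on
balls, no exponent increases. A product of two functions of the input would not have this property.
-/
theorem param_mul [ProperSpace E] {b : E → ℝ} (hb : ContDiff ℝ 2 b) {q : E → X → ℝ}
    (hq : ParamGrowth q) : ParamGrowth fun w z => b w * q w z where
  contDiff := (hb.comp contDiff_fst).mul hq.contDiff
  bound R := by
    obtain ⟨C, hC0, hC⟩ := hq.bound R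
    obtain ⟨D, hD0, hD⟩ := exists_norm_iteratedFDeriv_le hb R
    refine ⟨4 * (D * C), by positivity, fun w hw z n hn => ?_⟩
    have hu : 1 ≤ 1 + ‖z‖ := by linarith [norm_nonneg z]
    refine (norm_iteratedFDeriv_mul_le hb (hq.contDiff_left z) w (by exact_mod_cast hn)).trans ?_
    calc _ ≤ ∑ i ∈ Finset.range (n + 1), (n.choose i : ℝ) * D * (C * (1 + ‖z‖) ^ max n 1) := by
          refine Finset.sum_le_sum fun i hi => ?_
          have hin : i ≤ n := Nat.lt_succ_iff.1 (Finset.mem_range.1 hi)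
          gcongr
          · exact hD w hw i (hin.trans hn)
          · refine (hC w hw z (n - i) ((Nat.sub_le _ _).trans hn)).trans ?_
            gcongr
            exact Nat.sub_le _ _
      _ = (2 ^ n : ℕ) * (D * C) * (1 + ‖z‖) ^ max n 1 := by
          rw [← Nat.sum_range_choose, Nat.cast_sum, Finset.sum_mul, Finset.sum_mul]
          exact Finset.sum_congr rfl fun i _ => by ring
      _ ≤ 4 * (D * C) * (1 + ‖z‖) ^ max n 1 := by
          gcongr
          have : 2 ^ n ≤ 2 ^ 2 := Nat.pow_le_pow_right (by norm_num) hn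
          exact_mod_cast this

theorem iteratedFDeriv_sub_const_of_ne {g : E → G} {m : ℕ} (hm : m ≠ 0) (hg : ContDiff ℝ m g)
    (c : G) (x : E) : iteratedFDeriv ℝ m (fun y => g y - c) x = iteratedFDeriv ℝ m g x := by
  rw [fun_iteratedFDeriv_sub_apply hg.contDiffAt contDiffAt_const, iteratedFDeriv_const_of_ne hm]
  simp

/-- Faà di Bruno: a term of order n is a derivative of φ, which is bounded, times inner derivatives
of orders adding up to n, so the power n of 1 + ‖z‖ is reproduced. Order zero uses that φ is
Lipschitz. -/
theorem comp {φ : ℝ → ℝ} (hφ : ContDiff ℝ 2 φ) {K : ℝ}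
    (hK : ∀ n ∈ Finset.Icc 1 2, ∀ x, |iteratedDeriv n φ x| ≤ K) {q : E → X → ℝ}
    (hq : ParamGrowth q) : ParamGrowth fun w z => φ (q w z) where
  contDiff := hφ.comp hq.contDiff
  bound R := by
    obtain ⟨C, hC0, hC⟩ := hq.bound R
    have hK0 : 0 ≤ K := (abs_nonneg _).trans (hK 1 (by simp) 0)
    have hlip : ∀ x, |φ x| ≤ |φ 0| + K * |x| := by
      intro x
      have := Convex.norm_image_sub_le_of_norm_deriv_le (f := φ) (s := Set.univ) (x := 0) (y := x)
        (C := K) (fun y _ => hφ.differentiable (by norm_num) y)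
        (fun y _ => by simpa using hK 1 (by simp) y) convex_univ trivial trivial
      simp only [Real.norm_eq_abs, sub_zero] at this
      calc |φ x| = |φ 0 + (φ x - φ 0)| := by ring_nf
        _ ≤ |φ 0| + |φ x - φ 0| := abs_add_le _ _
        _ ≤ _ := by gcongr
    refine ⟨|φ 0| + K * C + 2 * K * (C + 1) ^ 2, by positivity, fun w hw z n hn => ?_⟩
    have hu : 1 ≤ 1 + ‖z‖ := by linarith [norm_nonneg z]
    have hun : 1 ≤ (1 + ‖z‖) ^ max n 1 := one_le_pow₀ hu
    rcases Nat.eq_zero_or_pos n with rfl | hnpos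
    · have h0 := hC w hw z 0 (by norm_num)
      rw [norm_iteratedFDeriv_zero, Real.norm_eq_abs] at h0 ⊢
      calc |φ (q w z)| ≤ |φ 0| * 1 + K * |q w z| := by simpa using hlip _
        _ ≤ |φ 0| * (1 + ‖z‖) ^ max 0 1 + K * (C * (1 + ‖z‖) ^ max 0 1) := by gcongr
        _ = (|φ 0| + K * C) * (1 + ‖z‖) ^ max 0 1 := by ring
        _ ≤ _ := mul_le_mul_of_nonneg_right (le_add_of_nonneg_right (by positivity))
          (by positivity)
    · set x₀ := q w z with hx₀
      -- The composition bound also asks for a bound on the outer function itself, which φ need not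
      -- satisfy; subtracting its value at the point makes this term zero without changing
      -- derivatives of positive order.
      set ψ : ℝ → ℝ := fun x => φ x - φ x₀ with hψ
      have hψc : ContDiff ℝ 2 ψ := hφ.sub contDiff_const
      have hn' : ((n : ℕ) : WithTop ℕ∞) ≤ 2 := by exact_mod_cast hn
      -- The bound needs the i-th inner derivative to be at most Dⁱ; C + 1 ≥ 1 ensures C ≤ (C + 1)ⁱ.
      have hb := norm_iteratedFDeriv_comp_le (n := n) (C := K) (D := (C + 1) * (1 + ‖z‖)) hψc
        (hq.contDiff_left z) hn' w ?_ ?_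
      · have hcongr : iteratedFDeriv ℝ n (ψ ∘ fun v => q v z) w =
            iteratedFDeriv ℝ n (fun v => φ (q v z)) w :=
          iteratedFDeriv_sub_const_of_ne hnpos.ne'
            ((hφ.comp (hq.contDiff_left z)).of_le hn') _ w
        rw [hcongr, mul_pow] at hb
        refine hb.trans ?_
        rw [max_eq_left hnpos]
        have hfac : ((n.factorial : ℕ) : ℝ) ≤ 2 := by
          interval_cases n <;> norm_num [Nat.factorial]
        calc _ ≤ 2 * K * ((C + 1) ^ 2 * (1 + ‖z‖) ^ n) := by
              gcongr
              linarith
          _ = (2 * K * (C + 1) ^ 2) * (1 + ‖z‖) ^ n := by ring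
          _ ≤ _ := mul_le_mul_of_nonneg_right (le_add_of_nonneg_left (by positivity))
            (by positivity)
      · intro i hi
        rcases Nat.eq_zero_or_pos i with rfl | hipos
        · rw [norm_iteratedFDeriv_zero]
          simpa [hψ, hx₀] using hK0
        · rw [iteratedFDeriv_sub_const_of_ne hipos.ne'
            (hφ.of_le (by exact_mod_cast hi.trans hn)), norm_iteratedFDeriv_eq_norm_iteratedDeriv]
          exact hK i (Finset.mem_Icc.2 ⟨hipos, hi.trans hn⟩) _
      · intro i hi1 hi2
        refine (hC w hw z i (hi2.trans hn)).trans ?_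
        rw [max_eq_left hi1, mul_pow]
        gcongr
        calc C ≤ C + 1 := by linarith
          _ ≤ (C + 1) ^ i := le_self_pow₀ (by linarith) (by omega)

theorem exists_bound {q : E → X → G} (h : ParamGrowth q) (R : ℝ) :
    ∃ C : ℝ, 0 ≤ C ∧ ∀ w, ‖w‖ ≤ R → ∀ z, ‖q w z‖ ≤ C * (1 + ‖z‖) ∧
      ‖fderiv ℝ (fun v => q v z) w‖ ≤ C * (1 + ‖z‖) ∧
      ‖fderiv ℝ (fderiv ℝ (fun v => q v z)) w‖ ≤ C * (1 + ‖z‖) ^ 2 := by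
  obtain ⟨C, hC0, hC⟩ := h.bound R
  refine ⟨C, hC0, fun w hw z => ⟨?_, ?_, ?_⟩⟩
  · simpa using hC w hw z 0 (by norm_num)
  · simpa using hC w hw z 1 (by norm_num)
  · rw [← norm_iteratedFDeriv_one, norm_iteratedFDeriv_fderiv]
    simpa using hC w hw z 2 le_rfl

end ParamGrowth

end ParamGrowth

/-! ### Growth of the perceptron in its input -/

namespace MLP

variable (A : MLP)

/-- Induction on the layer: a unit is an activation applied to a bias plus products of one weight
with one unit of the previous layer, and each of these operations preserves the growth condition. -/
theorem paramGrowth_layer (hact : A.SmoothActivations) : ∀ (l : ℕ) (hl : l ≤ A.depth)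
    (i : Fin (A.width l)), ParamGrowth fun (W : A.Weights) (z : A.Input) => A.layer W z l hl i := by
  intro l
  induction l with
  | zero => exact fun _ i => ParamGrowth.input (EuclideanSpace.proj i : A.Input →L[ℝ] ℝ)
  | succ l ih =>
    intro hl i
    obtain ⟨hsm, K, hK⟩ := hact l hl
    have hcoord : ∀ k : A.WeightIdx, ContDiff ℝ 2 fun W : A.Weights => W k := fun k =>
      (EuclideanSpace.proj k : A.Weights →L[ℝ] ℝ).contDiff
    refine ParamGrowth.comp (hsm.of_le (by norm_num)) (K := K) (fun n hn x => hK n ?_ x) ?_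
    · rw [Finset.mem_Icc] at hn ⊢
      omega
    · exact (ParamGrowth.param (hcoord _)).add (ParamGrowth.sum _ fun j _ =>
        ParamGrowth.param_mul (hcoord _) (ih (Nat.le_of_succ_le hl) j))

theorem paramGrowth_F (hact : A.SmoothActivations) :
    ParamGrowth fun (W : A.Weights) (z : A.Input) => A.F W z := by
  have h := ParamGrowth.sum Finset.univ fun (i : Fin (A.width A.depth)) _ =>
    (A.paramGrowth_layer hact A.depth le_rfl i).clm_comp
      (ContinuousLinearMap.toSpanSingleton ℝ (EuclideanSpace.single i (1 : ℝ)))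
  convert h using 3 with W z
  ext i
  simp [F, Finset.sum_apply, Pi.single_apply]

end MLP

/-! ### Translation of the perceptron setting into the regression model, and the main theorem -/

namespace MLP

variable {Ω : Type*} [MeasurableSpace Ω] {P : Measure Ω} [IsProbabilityMeasure P] (A : MLP)

theorem empCov_eq_of_empOuter (Y : ℕ → Ω → A.Output) (Z : ℕ → Ω → A.Input) (n : ℕ) (ω : Ω)
    (W : A.Weights) : A.empCov (fun t => Y t ω) (fun t => Z t ω) n W =
      Matrix.of (empOuter A.F Y Z n ω W) := by
  ext i j
  simp [empCov, empOuter, errorOuter, Matrix.sum_apply, vecMulVec_apply]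

theorem glsCost_eq_tracePairing (Γ : Matrix (Fin (A.width A.depth)) (Fin (A.width A.depth)) ℝ)
    (Y : ℕ → Ω → A.Output) (Z : ℕ → Ω → A.Input) (n : ℕ) (ω : Ω) (W : A.Weights) :
    A.glsCost Γ (fun t => Y t ω) (fun t => Z t ω) n W =
      tracePairing Γ⁻¹ (empOuter A.F Y Z n ω W) := by
  rw [glsCost, empOuter, map_smul, map_sum, smul_eq_mul, one_div]
  congr 1
  refine Finset.sum_congr rfl fun t _ => ?_
  rw [tracePairing_apply]
  simp only [dotProduct, mulVec, Finset.mul_sum, errorOuter, PiLp.sub_apply]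
  exact Finset.sum_congr rfl fun i _ => Finset.sum_congr rfl fun j _ => by ring

/-- The extended logarithm reflects the order, and `ENNReal.ofReal` loses nothing on nonnegative
determinants, so the value -∞ at singular covariances needs no separate treatment. -/
theorem isMinOn_det_of_logDetCost {Y : ℕ → Ω → A.Output} {Z : ℕ → Ω → A.Input} {n : ℕ} {ω : Ω}
    {Θ : Set A.Weights} {W : A.Weights}
    (hW : IsMinOn (A.logDetCost (fun t => Y t ω) (fun t => Z t ω) n) Θ W) :
    IsMinOn (fun V => (Matrix.of (empOuter A.F Y Z n ω V)).det) Θ W := by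
  intro V hV
  have h1 := ENNReal.log_le_log_iff.1 (hW hV)
  rw [A.empCov_eq_of_empOuter, A.empCov_eq_of_empOuter,
    ENNReal.ofReal_le_ofReal_iff (posSemidef_empOuter A.F Y Z n ω V).det_nonneg] at h1
  exact h1

theorem dotProduct_infoMatrix_mulVec {Y : ℕ → Ω → A.Output} {Z : ℕ → Ω → A.Input}
    {ε : Ω → A.Output} {W₀ : A.Weights}
    {Γ₀ : Matrix (Fin (A.width A.depth)) (Fin (A.width A.depth)) ℝ}
    (h : RegressionModel P A.F Y Z ε W₀ Γ₀) (u v : A.Weights) :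
    u.ofLp ⬝ᵥ A.infoMatrix P Γ₀ (Z 0) W₀ *ᵥ v.ofLp = fisherForm P A.F (Z 0) W₀ Γ₀ u v := by
  have hexp : ∀ (u : A.Weights) (z : A.Input) (i : Fin (A.width A.depth)),
      fderiv ℝ (fun W => A.F W z) W₀ u i = ∑ k, u k * A.partialF W₀ k z i := by
    intro u z i
    conv_lhs => rw [← (EuclideanSpace.basisFun A.WeightIdx ℝ).sum_repr u]
    simp [partialF]
  have hint : ∀ k l i j, Integrable
      (fun ω => A.partialF W₀ k (Z 0 ω) j * A.partialF W₀ l (Z 0 ω) i) P := fun k l i j =>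
    (h.memLp_deriv_coord _ j).integrable_mul (h.memLp_deriv_coord _ i)
  have hprod : ∀ i j, ∫ ω, fderiv ℝ (fun W => A.F W (Z 0 ω)) W₀ u j *
      fderiv ℝ (fun W => A.F W (Z 0 ω)) W₀ v i ∂P = ∑ k, ∑ l, u k * v l *
        ∫ ω, A.partialF W₀ k (Z 0 ω) j * A.partialF W₀ l (Z 0 ω) i ∂P := by
    intro i j
    simp_rw [← integral_const_mul]
    simp_rw [← integral_finsetSum Finset.univ fun l _ => (hint _ l i j).const_mul _]
    rw [← integral_finsetSum _ fun k _ => integrable_finsetSum _ fun l _ =>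
      (hint k l i j).const_mul _]
    refine integral_congr_ae (Eventually.of_forall fun ω => ?_)
    simp only [hexp, Finset.sum_mul_sum]
    exact Finset.sum_congr rfl fun k _ => Finset.sum_congr rfl fun l _ => by ring
  simp only [fisherForm, hprod, dotProduct, mulVec, infoMatrix, Matrix.of_apply, Matrix.trace,
    Matrix.diag_apply, Matrix.mul_apply, Finset.mul_sum, Finset.sum_mul]
  -- Each such round brings one output index outside the two sums over weights.
  rw [Finset.sum_congr rfl fun k _ => Finset.sum_comm, Finset.sum_comm]
  refine Finset.sum_congr rfl fun i _ => ?_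
  rw [Finset.sum_congr rfl fun k _ => Finset.sum_comm, Finset.sum_comm]
  exact Finset.sum_congr rfl fun j _ => Finset.sum_congr rfl fun k _ =>
    Finset.sum_congr rfl fun l _ => by ring

theorem regressionModel {A : MLP} (hact : A.SmoothActivations)
    {Y : ℕ → Ω → A.Output} {Z : ℕ → Ω → A.Input} {ε : Ω → A.Output} {W₀ : A.Weights}
    (hY : ∀ t, Measurable (Y t)) (hZ : ∀ t, Measurable (Z t))
    (hindep : iIndepFun (fun t ω => (Y t ω, Z t ω)) P)
    (hident : ∀ t, IdentDistrib (fun ω => (Y t ω, Z t ω)) (fun ω => (Y 0 ω, Z 0 ω)) P P)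
    (hmodel : ∀ ω, Y 0 ω = A.F W₀ (Z 0 ω) + ε ω) (hεZ : IndepFun ε (Z 0) P)
    (hε_mean : ∫ ω, ε ω ∂P = 0) (hε_mom : MemLp ε 2 P)
    {Γ₀ : Matrix (Fin (A.width A.depth)) (Fin (A.width A.depth)) ℝ}
    (hΓ₀ : Γ₀ = covarianceMatrix P ε) (hΓ₀_inv : IsUnit Γ₀) (hZ_mom : MemLp (Z 0) 3 P) :
    RegressionModel P A.F Y Z ε W₀ Γ₀ where
  contDiff := (A.paramGrowth_F hact).contDiff
  bound := (A.paramGrowth_F hact).exists_bound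
  measurable_Y := hY
  measurable_Z := hZ
  indep := hindep
  ident := hident
  model := hmodel
  indep_noise := hεZ
  noise_mean := hε_mean
  noise_memLp := hε_mom
  cov := hΓ₀
  isUnit_cov := hΓ₀_inv
  memLp_Z := hZ_mom

end MLP

theorem mainTheorem1
    {Ω : Type*} [MeasurableSpace Ω] (P : Measure Ω) [IsProbabilityMeasure P]
    (A : MLP) (hact : A.SmoothActivations)
    -- observations, noise, and the regression model
    (Y : ℕ → Ω → A.Output) (Z : ℕ → Ω → A.Input) (ε : ℕ → Ω → A.Output) (W₀ : A.Weights)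
    (hY : ∀ t, Measurable (Y t)) (hZ : ∀ t, Measurable (Z t))
    (hindep : iIndepFun (fun t ω => (Y t ω, Z t ω)) P)
    (hident : ∀ t, IdentDistrib (fun ω => (Y t ω, Z t ω)) (fun ω => (Y 0 ω, Z 0 ω)) P P)
    (hmodel : ∀ t ω, Y t ω = A.F W₀ (Z t ω) + ε t ω)
    -- the noise is centred, independent of the regressors, with invertible covariance
    (hεZ : ∀ t, IndepFun (ε t) (Z t) P)
    (hε_mean : ∀ t, ∫ ω, ε t ω ∂P = 0)
    (hε_mom : ∀ t, MemLp (ε t) 2 P)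
    (Γ₀ : Matrix (Fin (A.width A.depth)) (Fin (A.width A.depth)) ℝ)
    (hΓ₀ : Γ₀ = covarianceMatrix P (ε 0)) (hΓ₀_inv : IsUnit Γ₀)
    (hZ_mom : ∀ t, MemLp (Z t) 3 P)
    -- compact parameter set, interior and identifiable true parameter
    (Θ : Set A.Weights) (hΘ : IsCompact Θ) (hW₀ : W₀ ∈ interior Θ)
    (hident_param : ∀ W ∈ Θ, (∀ᵐ ω ∂P, A.F W (Z 0 ω) = A.F W₀ (Z 0 ω)) → W = W₀)
    (I₀ : Matrix A.WeightIdx A.WeightIdx ℝ)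
    (hI₀ : I₀ = A.infoMatrix P Γ₀ (Z 0) W₀) (hI₀_pos : I₀.PosDef)
    -- the two estimators
    (What Wstar : ℕ → Ω → A.Weights)
    (hWhat_meas : ∀ n, AEMeasurable (What n) P)
    (hWhat : ∀ n, ∀ᵐ ω ∂P, What n ω ∈ Θ ∧
      IsMinOn (A.logDetCost (fun t => Y t ω) (fun t => Z t ω) n) Θ (What n ω))
    (hWstar_meas : ∀ n, AEMeasurable (Wstar n) P)
    (hWstar : ∀ n, ∀ᵐ ω ∂P, Wstar n ω ∈ Θ ∧
      IsMinOn (A.glsCost Γ₀ (fun t => Y t ω) (fun t => Z t ω) n) Θ (Wstar n ω)) :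
    ConvergesInLaw P (fun n ω => √(n : ℝ) • (What n ω - W₀)) (multivariateGaussian 0 I₀⁻¹) ∧
    ConvergesInLaw P (fun n ω => √(n : ℝ) • (Wstar n ω - W₀)) (multivariateGaussian 0 I₀⁻¹) ∧
    SameAsymptoticLaw P (fun n ω => √(n : ℝ) • (What n ω - W₀))
      (fun n ω => √(n : ℝ) • (Wstar n ω - W₀)) := by
  have h : RegressionModel P A.F Y Z (ε 0) W₀ Γ₀ := MLP.regressionModel hact hY hZ hindep hident
    (hmodel 0) (hεZ 0) (hε_mean 0) (hε_mom 0) hΓ₀ hΓ₀_inv (hZ_mom 0)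
  have hI : ∀ u v : A.Weights,
      u.ofLp ⬝ᵥ I₀ *ᵥ v.ofLp = fisherForm P A.F (Z 0) W₀ Γ₀ u v := by
    rw [hI₀]
    exact A.dotProduct_infoMatrix_mulVec h
  have hdet : ConvergesInLaw P (fun (n : ℕ) ω => √(n : ℝ) • (What n ω - W₀))
      (multivariateGaussian 0 I₀⁻¹) :=
    h.tendstoInDistribution_det hΘ hW₀ hident_param hI₀_pos hI hWhat_meas fun n =>
      (hWhat n).mono fun ω hω => ⟨hω.1, A.isMinOn_det_of_logDetCost hω.2⟩
  have hgls : ConvergesInLaw P (fun (n : ℕ) ω => √(n : ℝ) • (Wstar n ω - W₀))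
      (multivariateGaussian 0 I₀⁻¹) :=
    h.tendstoInDistribution_gls hΘ hW₀ hident_param hI₀_pos hI hWstar_meas fun n =>
      (hWstar n).mono fun ω hω => ⟨hω.1, by
        simpa only [funext (A.glsCost_eq_tracePairing Γ₀ Y Z n ω)] using hω.2⟩
  exact ⟨hdet, hgls, multivariateGaussian 0 I₀⁻¹, inferInstance, hdet, hgls⟩
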